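/- Let $S=\bigcup_{n\ge 0}S_n$ (permutations written as words $\sigma(1)\cdots\sigma(n)$), let $T=\bigcup_{n\ge 0}T_n$ be the set of standard Young tableaux, $T_n$ being those with entries $1,\dots,n$, and let $P:S\to T$ send a permutation to its Schensted insertion tableau. For $v\in S_q$, $u\in S_p$ let $v\bigtriangleup u=\bar v u$, where $\bar v$ is obtained by adding $p$ to each letter of $v$. Let $\mathbb ZS$, $\mathbb ZT$ be the free $\mathbb Z$-modules on $S$ and $T$, let $P$ also denote the linear extension $\mathbb ZS\to\mathbb ZT$, and let $\delta(\sigma)=\sum_{0\le i\le n}\sigma|\{1,\dots,i\}\otimes \mathrm{st}(\sigma|\{i+1,\dots,n\})$ for $\sigma\in S_n$, where $\sigma|I$ keeps only the letters in $I$ and $\mathrm{st}$ is standardization. The map $P$ is surjective, and the product $\bigtriangleup$ and the coproduct $\delta$ pass to the quotient: there are well-defined $\bigtriangleup$ on $T$ and $\delta$ on $\mathbb ZT$ such that $P(v\bigtriangleup u)=P(v)\bigtriangleup P(u)$ and $\delta\circ P=(P\otimes P)\circ\delta$; this is the coproduct of the Hopf algebra $\mathbb ZT$ of tableaux, whose unit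 element is the empty tableau $\epsilon$. An element $x\in\mathbb ZT$ is primitive if $\delta(x)=x\otimes\epsilon+\epsilon\otimes x$. A tableau $\Sigma\neq\epsilon$ is indecomposable for $\bigtriangleup$ if $\Sigma=V\bigtriangleup U$ implies $V=\epsilon$ or $U=\epsilon$. Let $\le$ be the weak order on $T$: the transitive closure of the relation holding between $P(u)$ and $P(v)$ whenever $u,v\in S_n$ and $u\le v$ in the right weak order (inclusion of inversion sets by values). There is exactly one family $(\mathcal M_\Sigma)_{\Sigma\in T}$ in $\mathbb ZT$ such that $\Sigma=\sum_{\Sigma\le W}\mathcal M_W$ for every $\Sigma\in T$. **Corollary.** The submodule of primitive elements of $\mathbb ZT$ is spanned by the $\mathcal M_\Sigma$ with $\Sigma$ indecomposable for $\bigtriangleup$. This submodule is graded (it is the sum of its intersections with the homogeneous components $\mathbb ZT_n$), and for every $n\ge 0$ its component of degree $n$ has rank equal to the number of tableaux in $T_n$ that are indecomposable for $\bigtriangleup$. -/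

import Mathlib

open scoped TensorProduct

namespace TableauHopf

/-! ### Permutations as words -/

/-- `w` is the word `σ(1) σ(2) ⋯ σ(n)` of a permutation of `{1, …, n}`, `n = w.length`. -/
def IsPermWord (w : List ℕ) : Prop := w.Perm (List.range' 1 w.length)

/-- The disjoint union `S` of all symmetric groups, permutations being written as words. -/
def S : Type := {w : List ℕ // IsPermWord w}

/-- The number of letters of a permutation. -/
def S.size (s : S) : ℕ := s.1.length

/-- The standard permutation of a word without repeated letters: every letter is replaced by its
rank among the letters of the word. -/
def st (w : List ℕ) : List ℕ := w.map fun a => w.countP fun b => b ≤ a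

theorem IsPermWord.nodup {w : List ℕ} (h : IsPermWord w) : w.Nodup :=
  h.nodup_iff.2 (List.nodup_range' ..)

theorem isPermWord_of_nodup {w : List ℕ} (h : w.Nodup)
    (h' : ∀ a ∈ w, 1 ≤ a ∧ a ≤ w.length) : IsPermWord w := by
  refine (List.subperm_of_subset h fun a ha => ?_).perm_of_length_le (by simp)
  have := h' a ha
  rw [List.mem_range'_1]
  omega

theorem isPermWord_st {w : List ℕ} (h : w.Nodup) : IsPermWord (st w) := by
  have key : ∀ a ∈ w, ∀ b, b < a →
      (w.countP fun c => c ≤ b) < w.countP fun c => c ≤ a := by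
    intro a ha b hb
    have h1 : (w.countP fun c => c ≤ a)
        = (w.filter fun c => c ≤ a).length := List.countP_eq_length_filter
    have h2 : (w.countP fun c => c ≤ b)
        = (w.filter fun c => c ≤ b).length := List.countP_eq_length_filter
    rw [h1, h2, ← List.toFinset_card_of_nodup (h.filter _),
      ← List.toFinset_card_of_nodup (h.filter _)]
    apply Finset.card_lt_card
    rw [Finset.ssubset_iff_of_subset]
    · exact ⟨a, by simp [ha], by simp [hb]⟩
    · intro c
      simp only [List.mem_toFinset, List.mem_filter, decide_eq_true_eq]
      rintro ⟨hc, hcb⟩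
      exact ⟨hc, by omega⟩
  apply isPermWord_of_nodup
  · refine List.Nodup.map_on ?_ h
    intro a ha b hb hab
    rcases lt_trichotomy a b with hlt | heq | hgt
    · have := key b hb a hlt
      omega
    · exact heq
    · have := key a ha b hgt
      omega
  · intro a ha
    simp only [st, List.mem_map, List.length_map] at ha ⊢
    obtain ⟨b, hb, rfl⟩ := ha
    refine ⟨?_, List.countP_le_length⟩
    exact List.countP_pos_iff.2 ⟨b, hb, by simp⟩

/-- `st (s ∣ I)`: keep only the letters of `s` in `I`, then standardize. -/
def S.restr (s : S) (I : Finset ℕ) : S :=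
  ⟨st (s.1.filter fun a => a ∈ I), isPermWord_st (s.2.nodup.filter _)⟩

/-- The left shifted concatenation `v △ u`: the letters of `v` are increased by the length of `u`
and the resulting word is put in front of `u`. -/
def S.tri (v u : S) : S :=
  ⟨v.1.map (fun a => a + u.1.length) ++ u.1, by
    have h1 := v.2.map fun a => u.1.length + a
    rw [List.map_add_range', add_comm u.1.length 1,
      show (fun a => u.1.length + a) = (fun a => a + u.1.length) from
        funext fun a => add_comm _ _] at h1
    have h2 := List.perm_append_comm.trans (u.2.append h1)
    rw [List.range'_append_1] at h2
    unfold IsPermWord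
    rwa [List.length_append, List.length_map, add_comm v.1.length]⟩

/-- The right weak order: inclusion of the sets of inversions by values. The pair `(j, i)`, `i < j`,
is an inversion of a word if `j` appears on the left of `i` in it. -/
def S.weakLE (s t : S) : Prop :=
  s.size = t.size ∧ ∀ i j : ℕ, i < j → [j, i].Sublist s.1 → [j, i].Sublist t.1

/-! ### Tableaux and Schensted insertion -/

/-- The row `s` may be put on top of the row `r`: it is not longer than `r`, and each of its entries
is larger than the entry of `r` in the same column. -/
def Below : List ℕ → List ℕ → Prop
  | _, [] => True
  | [], _ :: _ => False
  | a :: r, b :: s => a < b ∧ Below r s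

/-- A Young tableau with strictly increasing rows and columns, as the list of its rows, the first
row being the longest one. -/
def IsTableau (t : List (List ℕ)) : Prop :=
  (∀ r ∈ t, r ≠ [] ∧ r.Pairwise (· < ·)) ∧ t.IsChain Below

/-- The set `T` of standard Young tableaux: the entries are `1, …, n`, each occurring once. -/
def T : Type := {t : List (List ℕ) // IsTableau t ∧ IsPermWord t.flatten}

/-- The number of boxes of a tableau. -/
def T.size (A : T) : ℕ := A.1.flatten.length

/-- The empty tableau. -/
def T.empty : T := ⟨[], by simp [IsTableau, IsPermWord]⟩

/-- Insert `x` in a row: `x` replaces the leftmost entry larger than `x`, which is returned as the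
second component, or is put at the end of the row if there is no such entry. -/
def insertRow : List ℕ → ℕ → List ℕ × Option ℕ
  | [], x => ([x], none)
  | a :: r, x =>
    if x < a then (x :: r, some a) else (a :: (insertRow r x).1, (insertRow r x).2)

/-- Schensted insertion of `x` in a tableau: an entry bumped from a row is inserted in the next
row. -/
def insertTab : List (List ℕ) → ℕ → List (List ℕ)
  | [], x => [[x]]
  | r :: t, x =>
    match (insertRow r x).2 with
    | none => (insertRow r x).1 :: t
    | some b => (insertRow r x).1 :: insertTab t b

/-- The insertion tableau of a word. -/
def insertWord (w : List ℕ) : List (List ℕ) := w.foldl insertTab []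

theorem insertRow_perm (r : List ℕ) (x : ℕ) :
    ((insertRow r x).2.toList ++ (insertRow r x).1).Perm (x :: r) := by
  induction r with
  | nil => simp [insertRow]
  | cons a r ih =>
    unfold insertRow
    split_ifs with h
    · exact List.Perm.swap _ _ _
    · exact List.perm_middle.trans ((ih.cons a).trans (List.Perm.swap _ _ _))

theorem insertRow_ne_nil (r : List ℕ) (x : ℕ) : (insertRow r x).1 ≠ [] := by
  cases r with
  | nil => simp [insertRow]
  | cons a r => unfold insertRow; split_ifs <;> simp

theorem mem_insertRow {r : List ℕ} {x y : ℕ} (hy : y ∈ (insertRow r x).1) : y = x ∨ y ∈ r := by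
  have := (insertRow_perm r x).subset (List.mem_append_right _ hy)
  simpa using this

theorem mem_bump {r : List ℕ} {x b : ℕ} (hb : (insertRow r x).2 = some b) : b ∈ r := by
  induction r with
  | nil => simp [insertRow] at hb
  | cons a r ih =>
    unfold insertRow at hb
    split_ifs at hb with h
    · simp at hb
      simp [hb]
    · exact List.mem_cons_of_mem _ (ih hb)

theorem insertRow_sorted {r : List ℕ} {x : ℕ} (hr : r.Pairwise (· < ·)) (hx : x ∉ r) :
    (insertRow r x).1.Pairwise (· < ·) := by
  induction r with
  | nil => simp [insertRow]
  | cons a r ih =>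
    rw [List.pairwise_cons] at hr
    simp only [List.mem_cons, not_or] at hx
    unfold insertRow
    split_ifs with h
    · exact List.pairwise_cons.2 ⟨fun y hy => h.trans (hr.1 y hy), hr.2⟩
    · refine List.pairwise_cons.2 ⟨fun y hy => ?_, ih hr.2 hx.2⟩
      rcases mem_insertRow hy with rfl | hy
      · omega
      · exact hr.1 y hy

theorem below_insertRow {r s : List ℕ} {x : ℕ} (h : Below r s) : Below (insertRow r x).1 s := by
  induction r generalizing s with
  | nil =>
    cases s with
    | nil => simp [Below]
    | cons b s => simp [Below] at h
  | cons a r ih =>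
    cases s with
    | nil => simp [Below]
    | cons b s =>
      unfold insertRow
      split_ifs with hx
      · exact ⟨hx.trans h.1, h.2⟩
      · exact ⟨h.1, ih h.2⟩

theorem below_insertRow_bump {r s : List ℕ} {x b : ℕ} (hr : r.Pairwise (· < ·)) (h : Below r s)
    (hb : (insertRow r x).2 = some b) : Below (insertRow r x).1 (insertRow s b).1 := by
  induction r generalizing s with
  | nil => simp [insertRow] at hb
  | cons a r ih =>
    rw [List.pairwise_cons] at hr
    unfold insertRow at hb
    rw [insertRow.eq_def (a :: r)]
    dsimp only
    split_ifs at hb ⊢ with hx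
    · simp only [Option.some.injEq] at hb
      subst hb
      cases s with
      | nil => simpa [insertRow, Below] using hx
      | cons c s => simpa [insertRow, h.1, Below] using ⟨hx, h.2⟩
    · have hab : a < b := hr.1 b (mem_bump hb)
      cases s with
      | nil => simpa [insertRow, Below] using hab
      | cons c s =>
        rw [insertRow.eq_def (c :: s)]
        dsimp only
        split_ifs with hbc
        · exact ⟨hab, below_insertRow h.2⟩
        · exact ⟨h.1, ih hr.2 h.2 hb⟩

theorem insertTab_perm (t : List (List ℕ)) (x : ℕ) :
    (insertTab t x).flatten.Perm (x :: t.flatten) := by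
  induction t generalizing x with
  | nil => simp [insertTab]
  | cons r t ih =>
    have h := insertRow_perm r x
    unfold insertTab
    cases hb : (insertRow r x).2 with
    | none =>
      rw [hb] at h
      simpa using h.append_right t.flatten
    | some b =>
      rw [hb] at h
      have h1 := (ih b).append_left (insertRow r x).1
      have h2 := h.append_right t.flatten
      simp only [Option.toList_some, List.cons_append, List.nil_append] at h2
      simpa using h1.trans (List.perm_middle.trans h2)

theorem insertTab_head (t : List (List ℕ)) (x : ℕ) :
    ∃ t', insertTab t x = (insertRow (t.headD []) x).1 :: t' := by
  cases t with
  | nil => exact ⟨[], rfl⟩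
  | cons r t =>
    unfold insertTab
    cases hb : (insertRow r x).2 <;> exact ⟨_, rfl⟩

theorem isTableau_insertTab {t : List (List ℕ)} {x : ℕ} (ht : IsTableau t)
    (hn : (x :: t.flatten).Nodup) : IsTableau (insertTab t x) := by
  induction t generalizing x with
  | nil => simp [insertTab, IsTableau]
  | cons r t ih =>
    obtain ⟨h1, h2⟩ := ht
    have hr := (h1 r (by simp)).2
    have hx : x ∉ r := fun h => (List.nodup_cons.1 hn).1 (by simp [h])
    have ht' : IsTableau t := ⟨fun s hs => h1 s (by simp [hs]), h2.tail⟩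
    have hrow := insertRow_sorted hr hx
    have hne := insertRow_ne_nil r x
    unfold insertTab
    cases hb : (insertRow r x).2 with
    | none =>
      refine ⟨?_, ?_⟩
      · intro s hs
        rcases List.mem_cons.1 hs with rfl | hs
        · exact ⟨hne, hrow⟩
        · exact ht'.1 s hs
      · cases t with
        | nil => simp
        | cons s t =>
          rw [List.isChain_cons_cons] at h2 ⊢
          exact ⟨below_insertRow h2.1, h2.2⟩
    | some b =>
      have hn' : (b :: t.flatten).Nodup := by
        have h3 : (r ++ t.flatten).Nodup := by simpa using (List.nodup_cons.1 hn).2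
        rw [List.nodup_append'] at h3
        exact List.nodup_cons.2 ⟨fun h => h3.2.2 (mem_bump hb) h, h3.2.1⟩
      have ht2 := ih ht' hn'
      refine ⟨?_, ?_⟩
      · intro s hs
        rcases List.mem_cons.1 hs with rfl | hs
        · exact ⟨hne, hrow⟩
        · exact ht2.1 s hs
      · obtain ⟨t', ht3⟩ := insertTab_head t b
        dsimp only
        rw [ht3] at ht2 ⊢
        rw [List.isChain_cons_cons]
        refine ⟨below_insertRow_bump hr ?_ hb, ht2.2⟩
        cases t with
        | nil => simp [Below]
        | cons s t => exact (List.isChain_cons_cons.1 h2).1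

theorem foldl_insertTab {w : List ℕ} {t : List (List ℕ)} (ht : IsTableau t)
    (hn : (w ++ t.flatten).Nodup) :
    IsTableau (w.foldl insertTab t) ∧ (w.foldl insertTab t).flatten.Perm (w ++ t.flatten) := by
  induction w generalizing t with
  | nil => exact ⟨ht, List.Perm.refl _⟩
  | cons x w ih =>
    have hp : (w ++ (insertTab t x).flatten).Perm (x :: w ++ t.flatten) :=
      ((insertTab_perm t x).append_left w).trans List.perm_middle
    have hx : (x :: t.flatten).Nodup :=
      hn.sublist (List.Sublist.cons_cons x (List.sublist_append_right w _))
    have := ih (isTableau_insertTab ht hx) (hp.nodup_iff.2 hn)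
    exact ⟨this.1, this.2.trans hp⟩

theorem insertWord_perm (s : S) : (insertWord s.1).flatten.Perm s.1 := by
  simpa [insertWord] using (foldl_insertTab (w := s.1) (t := []) (by simp [IsTableau])
    (by simpa using s.2.nodup)).2

/-- The tableau `P(s)` associated with the permutation `s` by the Schensted correspondence. -/
def P (s : S) : T :=
  ⟨insertWord s.1, (foldl_insertTab (w := s.1) (t := []) (by simp [IsTableau])
    (by simpa using s.2.nodup)).1, by
      have h := insertWord_perm s
      unfold IsPermWord
      rw [h.length_eq]
      exact h.trans s.2⟩

theorem size_P (s : S) : (P s).size = s.size := (insertWord_perm s).length_eq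

/-- The row reading word of a tableau: its rows, from the last one to the first one. It is a
permutation whose insertion tableau is the given tableau. -/
def T.word (A : T) : S :=
  ⟨A.1.reverse.flatten, by
    have h : A.1.reverse.flatten.Perm A.1.flatten := (List.reverse_perm A.1).flatten
    unfold IsPermWord
    rw [h.length_eq]
    exact h.trans A.2.2⟩

/-- The product `V △ U` of tableaux induced by the product `△` of permutations. -/
def T.tri (V U : T) : T := P (V.word.tri U.word)

/-- A tableau is indecomposable for `△` if it is not empty and not the product of two nonempty
tableaux. -/
def T.Indecomposable (A : T) : Prop :=
  A ≠ T.empty ∧ ∀ V U : T, A = V.tri U → V = T.empty ∨ U = T.empty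

/-- The weak order of tableaux: the transitive closure of the relation that holds between `P(u)`
and `P(v)` whenever `u ≤ v` in the weak order of permutations. -/
def T.weakLE : T → T → Prop :=
  Relation.TransGen fun U V => ∃ u v : S, P u = U ∧ P v = V ∧ u.weakLE v

theorem T.weakLE.size_eq {U V : T} (h : U.weakLE V) : U.size = V.size := by
  induction h with
  | single h =>
    obtain ⟨u, v, rfl, rfl, h⟩ := h
    rw [size_P, size_P, h.1]
  | tail _ h ih =>
    obtain ⟨u, v, rfl, rfl, h⟩ := h
    rw [ih, size_P, size_P, h.1]

theorem length_le_length_flatten {t : List (List ℕ)} (h : ∀ r ∈ t, r ≠ []) :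
    t.length ≤ t.flatten.length := by
  induction t with
  | nil => simp
  | cons r t ih =>
    have h1 := ih fun s hs => h s (by simp [hs])
    have h2 := List.length_pos_iff.2 (h r (by simp))
    simp only [List.length_cons, List.flatten_cons, List.length_append]
    omega

theorem finite_size (n : ℕ) : {A : T | A.size = n}.Finite := by
  let rows : Set (List ℕ) :=
    (fun l : List (Fin (n + 1)) => l.map Fin.val) '' {l | l.length ≤ n}
  have hrows : rows.Finite := (List.finite_length_le (Fin (n + 1)) n).image _
  have : Finite rows := hrows
  have hfin : ((fun l : List rows => l.map Subtype.val) '' {l | l.length ≤ n}).Finite :=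
    (List.finite_length_le rows n).image _
  refine Set.Finite.of_finite_image (f := Subtype.val) (hfin.subset ?_)
    Subtype.val_injective.injOn
  rintro _ ⟨A, hA, rfl⟩
  have hA' : A.1.flatten.length = n := hA
  have hmem : ∀ r ∈ A.1, r ∈ rows := by
    intro r hr
    have hlt : ∀ a ∈ r, a < n + 1 := by
      intro a ha
      have h1 := A.2.2.subset (List.mem_flatten.2 ⟨r, hr, ha⟩)
      rw [hA', List.mem_range'_1] at h1
      omega
    refine ⟨r.attach.map fun a => ⟨a.1, hlt a.1 a.2⟩, ?_, ?_⟩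
    · simp only [Set.mem_ofPred_eq, List.length_map, List.length_attach]
      rw [← hA']
      exact (List.sublist_flatten_of_mem hr).length_le
    · simp [List.map_map, Function.comp_def]
  refine ⟨A.1.attach.map fun r => ⟨r.1, hmem r.1 r.2⟩, ?_, ?_⟩
  · simp only [Set.mem_ofPred_eq, List.length_map, List.length_attach]
    rw [← hA']
    exact length_le_length_flatten fun r hr => (A.2.1.1 r hr).1
  · simp [List.map_map, Function.comp_def]

theorem finite_above (A : T) : {W : T | A.weakLE W}.Finite :=
  (finite_size A.size).subset fun _ h => h.size_eq.symm

/-- The finite set of all tableaux `W` with `A ≤ W`. -/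
noncomputable def T.above (A : T) : Finset T := (finite_above A).toFinset

/-! ### The coalgebras of permutations and of tableaux -/

/-- The free `ℤ`-module on the set of permutations. -/
abbrev ZS : Type := S →₀ ℤ

/-- The free `ℤ`-module on the set of tableaux. -/
abbrev ZT : Type := T →₀ ℤ

/-- The coproduct of `ZS`, sending `s` in `S_n` to the sum over `0 ≤ i ≤ n` of
`(s ∣ {1, …, i}) ⊗ st (s ∣ {i + 1, …, n})`. The left factor is already standard. -/
noncomputable def deltaS : ZS →ₗ[ℤ] ZS ⊗[ℤ] ZS :=
  Finsupp.linearCombination ℤ fun s : S =>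
    ∑ i ∈ Finset.range (s.size + 1),
      (Finsupp.single (s.restr (Finset.Icc 1 i)) (1 : ℤ) : ZS) ⊗ₜ[ℤ]
        (Finsupp.single (s.restr (Finset.Icc (i + 1) s.size)) (1 : ℤ) : ZS)

/-- The linear extension `ZS → ZT` of the map `P`. -/
noncomputable def linP : ZS →ₗ[ℤ] ZT := Finsupp.lmapDomain ℤ ℤ P

/-- The coproduct of `ZT`, induced by that of `ZS` through `P`: the image of a tableau is computed
from the coproduct of its reading word. -/
noncomputable def deltaT : ZT →ₗ[ℤ] ZT ⊗[ℤ] ZT :=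
  Finsupp.linearCombination ℤ fun A : T =>
    TensorProduct.map linP linP (deltaS (Finsupp.single A.word 1))

/-- The unit element of `ZT`, namely the empty tableau. -/
noncomputable def oneT : ZT := Finsupp.single T.empty 1

/-- The submodule of primitive elements of `ZT`. -/
noncomputable def primitives : Submodule ℤ ZT where
  carrier := {x | deltaT x = x ⊗ₜ[ℤ] oneT + oneT ⊗ₜ[ℤ] x}
  add_mem' := by
    intro x y hx hy
    simp only [Set.mem_ofPred_eq] at hx hy ⊢
    rw [map_add, hx, hy, TensorProduct.add_tmul, TensorProduct.tmul_add]
    abel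
  zero_mem' := by simp
  smul_mem' := by
    intro c x hx
    simp only [Set.mem_ofPred_eq] at hx ⊢
    rw [map_smul, hx, smul_add, TensorProduct.smul_tmul', TensorProduct.tmul_smul]

/-- The homogeneous component of degree `n` of `ZT`, spanned by the tableaux with `n` boxes. -/
noncomputable def homogeneous (n : ℕ) : Submodule ℤ ZT :=
  Finsupp.supported ℤ ℤ {A : T | A.size = n}

/-- The identities that define the monomial basis `M` by Möbius inversion: every tableau `A` is the
sum of the `M W` over all tableaux `W` with `A ≤ W`. -/
def IsMonomialBasis (M : T → ZT) : Prop :=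
  ∀ A : T, (Finsupp.single A 1 : ZT) = ∑ W ∈ A.above, M W

end TableauHopf

open TableauHopf

/-! Everything rests on a duality: in the basis `M`, the coproduct is dual to the product `△`. The
identity defining `M` says that the coefficient of `M W` in a tableau `A` is 1 if `A ≤ W` and 0
otherwise; these coefficients form the zeta transform `zeta`. Splitting `A` at height `i` into
`A.low i` and `A.high i` is adjoint to `△`: `A ≤ V △ U` holds exactly when the low part of `A` at
height `U.size` is `≤ U` and the high part is `≤ V` (`T.weakLE_tri_iff`). Hence the coefficient of
`M U ⊗ M V` in `deltaT x` is the coefficient of `M (V △ U)` in `x` (`zetaTensor_deltaT_apply`).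
Primitivity therefore means that the coefficients vanish at the empty tableau and at every product
of two nonempty tableaux, so the primitive elements have the `M A` with `A` indecomposable as a
basis. The weak order only compares tableaux of equal size, which gives the grading and the ranks.

Two facts about Schensted insertion are needed. Compatibility of `P` with `△` and with restriction
to intervals comes from Knuth equivalence: each word is equivalent to the reading word of its
insertion tableau (`knuth_insertWord`), and equivalent words have the same tableau (`Knuth.P_eq`).
Invertibility of the zeta transform needs antisymmetry of the weak order on tableaux
(`T.weakLE.antisymm`).

Both `Knuth.P_eq` and antisymmetry come from Greene's theorem, applied to the letters at most `j`:
the largest total size of `k` disjoint increasing subsequences is invariant under Knuth moves,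
equals the number of entries at most `j` in the first `k` rows, and can only decrease when
inversions are added. These numbers, for all `j` and `k`, determine the tableau. -/

namespace TableauHopf

/-! ### Knuth equivalence -/

/-- An elementary Knuth transformation of words. -/
inductive KnuthStep : List ℕ → List ℕ → Prop
  | left (l r : List ℕ) {x y z : ℕ} (hxy : x < y) (hyz : y < z) :
      KnuthStep (l ++ y :: x :: z :: r) (l ++ y :: z :: x :: r)
  | right (l r : List ℕ) {x y z : ℕ} (hxy : x < y) (hyz : y < z) :
      KnuthStep (l ++ x :: z :: y :: r) (l ++ z :: x :: y :: r)

/-- The Knuth (plactic) equivalence of words. -/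
def Knuth : List ℕ → List ℕ → Prop := Relation.EqvGen KnuthStep

namespace Knuth

theorem refl (w : List ℕ) : Knuth w w := Relation.EqvGen.refl w

theorem symm {v w : List ℕ} (h : Knuth v w) : Knuth w v := Relation.EqvGen.symm _ _ h

theorem trans {u v w : List ℕ} (h : Knuth u v) (h' : Knuth v w) : Knuth u w :=
  Relation.EqvGen.trans _ _ _ h h'

theorem of_step {v w : List ℕ} (h : KnuthStep v w) : Knuth v w := Relation.EqvGen.rel _ _ h

theorem lift {f : List ℕ → List ℕ} (hf : ∀ v w, KnuthStep v w → Knuth (f v) (f w))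
    {v w : List ℕ} (h : Knuth v w) : Knuth (f v) (f w) := by
  induction h with
  | rel _ _ h => exact hf _ _ h
  | refl => exact refl _
  | symm _ _ _ ih => exact ih.symm
  | trans _ _ _ _ _ ih ih' => exact ih.trans ih'

theorem append_left (l : List ℕ) {v w : List ℕ} (h : Knuth v w) : Knuth (l ++ v) (l ++ w) := by
  refine h.lift fun v w h => ?_
  cases h with
  | left l' r h h' => simpa using of_step (KnuthStep.left (l ++ l') r h h')
  | right l' r h h' => simpa using of_step (KnuthStep.right (l ++ l') r h h')

theorem append_right (r : List ℕ) {v w : List ℕ} (h : Knuth v w) : Knuth (v ++ r) (w ++ r) := by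
  refine h.lift (f := (· ++ r)) fun v w h => ?_
  cases h with
  | left l r' h h' => simpa using of_step (KnuthStep.left l (r' ++ r) h h')
  | right l r' h h' => simpa using of_step (KnuthStep.right l (r' ++ r) h h')

theorem append {v w v' w' : List ℕ} (h : Knuth v w) (h' : Knuth v' w') :
    Knuth (v ++ v') (w ++ w') :=
  (h.append_right v').trans (h'.append_left w)

theorem cons (a : ℕ) {v w : List ℕ} (h : Knuth v w) : Knuth (a :: v) (a :: w) :=
  h.append_left [a]

theorem perm {v w : List ℕ} (h : Knuth v w) : v.Perm w := by
  induction h with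
  | rel _ _ h =>
    cases h with
    | left l r => exact ((List.Perm.swap _ _ _).cons _).append_left l
    | right l r => exact (List.Perm.swap _ _ _).append_left l
  | refl => exact List.Perm.refl _
  | symm _ _ _ ih => exact ih.symm
  | trans _ _ _ _ _ ih ih' => exact ih.trans ih'

theorem map {f : ℕ → ℕ} {v w : List ℕ} (h : Knuth v w)
    (hf : ∀ a ∈ v, ∀ b ∈ v, a < b → f a < f b) : Knuth (v.map f) (w.map f) := by
  induction h with
  | rel _ _ h =>
    cases h with
    | left l r h h' =>
      simpa using of_step (KnuthStep.left (l.map f) (r.map f)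
        (hf _ (by simp) _ (by simp) h) (hf _ (by simp) _ (by simp) h'))
    | right l r h h' =>
      simpa using of_step (KnuthStep.right (l.map f) (r.map f)
        (hf _ (by simp) _ (by simp) h) (hf _ (by simp) _ (by simp) h'))
  | refl => exact refl _
  | symm v w h ih =>
    have hp := perm h
    exact (ih fun a ha b hb => hf a (hp.subset ha) b (hp.subset hb)).symm
  | trans v w _ h _ ih ih' =>
    have hp := perm h
    exact (ih hf).trans (ih' fun a ha b hb => hf a (hp.symm.subset ha) b (hp.symm.subset hb))

/-- Convexity of `p` is the point: if the exchanged letters `x` and `z` both survive, so does the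
witness `y`, and the move is still allowed. If one of them is erased, the two filtered words
coincide. -/
theorem filter {p : ℕ → Bool} (hp : ∀ x y z, x < y → y < z → p x → p z → p y)
    {v w : List ℕ} (h : Knuth v w) : Knuth (v.filter p) (w.filter p) := by
  refine h.lift fun v w h => ?_
  cases h with
  | @left l r x y z h h' =>
    have key := hp x y z h h'
    by_cases hx : p x <;> by_cases hy : p y <;> by_cases hz : p z <;>
      simp [hx, hy, hz] at key ⊢ <;>
      first
        | exact refl _
        | exact of_step (KnuthStep.left _ _ h h')
  | @right l r x y z h h' =>
    have key := hp x y z h h'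
    by_cases hx : p x <;> by_cases hy : p y <;> by_cases hz : p z <;>
      simp [hx, hy, hz] at key ⊢ <;>
      first
        | exact refl _
        | exact of_step (KnuthStep.right _ _ h h')

end Knuth

theorem countP_le_lt_countP_le {w : List ℕ} {a b : ℕ} (hb : b ∈ w) (hab : a < b) :
    (w.countP fun c => c ≤ a) < w.countP fun c => c ≤ b := by
  obtain ⟨l, r, rfl⟩ := List.append_of_mem hb
  have h1 : (l.countP fun c => c ≤ a) ≤ l.countP fun c => c ≤ b :=
    List.countP_mono_left fun c _ h => by simp at h ⊢; omega
  have h2 : (r.countP fun c => c ≤ a) ≤ r.countP fun c => c ≤ b :=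
    List.countP_mono_left fun c _ h => by simp at h ⊢; omega
  rw [List.countP_append, List.countP_append, List.countP_cons_of_neg (by simpa using hab),
    List.countP_cons_of_pos (by simp)]
  omega

/-- Ranks depend only on the set of letters, so rearrangements of one word are standardized by one
common relabelling. -/
theorem st_eq_map_of_perm {v w : List ℕ} (h : v.Perm w) :
    st w = w.map fun a => v.countP fun b => b ≤ a := by
  unfold st
  refine List.map_congr_left fun a _ => (h.countP_eq _).symm

theorem Knuth.st {v w : List ℕ} (h : Knuth v w) : Knuth (st v) (st w) := by
  rw [st_eq_map_of_perm h.perm]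
  exact h.map fun a _ b hb hab => countP_le_lt_countP_le hb hab

/-! ### A word is Knuth equivalent to the reading word of its insertion tableau -/

/-- The small letter `x` moves left through the row by moves `a c x → a x c` with `x < a < c`, until
it stands just after the first entry. -/
theorem knuth_row_append {a x : ℕ} {r : List ℕ} (hr : (a :: r).Pairwise (· < ·)) (hx : x < a) :
    Knuth (a :: r ++ [x]) (a :: x :: r) := by
  induction r generalizing a with
  | nil => exact Knuth.refl _
  | cons c r ih =>
    rw [List.pairwise_cons] at hr
    have hac : a < c := hr.1 c (by simp)
    exact ((ih hr.2 (hx.trans hac)).cons a).trans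
      (Knuth.of_step (KnuthStep.left [] r hx hac)).symm

theorem insertRow_none {r : List ℕ} {x : ℕ} (h : (insertRow r x).2 = none) :
    (insertRow r x).1 = r ++ [x] := by
  induction r with
  | nil => rfl
  | cons a r ih =>
    unfold insertRow at h ⊢
    split_ifs at h ⊢
    simpa using ih h

theorem insertRow_head_lt {r : List ℕ} {x b : ℕ} (hr : r.Pairwise (· < ·))
    (h : (insertRow r x).2 = some b) :
    ∃ y s, (insertRow r x).1 = y :: s ∧ y < b := by
  cases r with
  | nil => simp [insertRow] at h
  | cons a r =>
    unfold insertRow at h ⊢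
    split_ifs at h ⊢ with hx
    · simp only [Option.some.injEq] at h
      exact ⟨x, r, rfl, h ▸ hx⟩
    · exact ⟨a, _, rfl, (List.pairwise_cons.1 hr).1 b (mem_bump h)⟩

/-- Once `x` has taken the place of `b`, the bumped letter `b` moves to the front by moves `a b y →
b a y` with `a < y < b`. The witness `y` is the entry after `a` in the new row. -/
theorem knuth_insertRow {r : List ℕ} {x b : ℕ} (hr : r.Pairwise (· < ·)) (hx : x ∉ r)
    (h : (insertRow r x).2 = some b) : Knuth (r ++ [x]) (b :: (insertRow r x).1) := by
  induction r with
  | nil => simp [insertRow] at h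
  | cons a r ih =>
    unfold insertRow at h ⊢
    split_ifs at h ⊢ with hxa
    · simp only [Option.some.injEq] at h
      subst h
      exact knuth_row_append hr hxa
    · rw [List.pairwise_cons] at hr
      simp only [List.mem_cons, not_or] at hx
      refine ((ih hr.2 hx.2 h).cons a).trans ?_
      obtain ⟨y, s, hy, hyb⟩ := insertRow_head_lt hr.2 h
      have hay : a < y := by
        rcases mem_insertRow (r := r) (x := x) (y := y) (by simp [hy]) with rfl | h
        · omega
        · exact hr.1 y h
      simp only [hy]
      exact Knuth.of_step (KnuthStep.right [] s hay hyb)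

theorem knuth_insertTab {t : List (List ℕ)} {x : ℕ} (ht : ∀ r ∈ t, r.Pairwise (· < ·))
    (hn : (x :: t.flatten).Nodup) :
    Knuth (t.reverse.flatten ++ [x]) (insertTab t x).reverse.flatten := by
  induction t generalizing x with
  | nil => exact Knuth.refl _
  | cons r t ih =>
    have hx : x ∉ r := fun h => (List.nodup_cons.1 hn).1 (by simp [h])
    unfold insertTab
    cases hb : (insertRow r x).2 with
    | none => simpa [insertRow_none hb] using Knuth.refl _
    | some b =>
      have hn' : (b :: t.flatten).Nodup := by
        have h3 : (r ++ t.flatten).Nodup := by simpa using (List.nodup_cons.1 hn).2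
        rw [List.nodup_append'] at h3
        exact List.nodup_cons.2 ⟨fun h => h3.2.2 (mem_bump hb) h, h3.2.1⟩
      have h1 := (knuth_insertRow (ht r (by simp)) hx hb).append_left t.reverse.flatten
      have h2 := (ih (fun s hs => ht s (by simp [hs])) hn').append_right (insertRow r x).1
      simpa using h1.trans (by simpa using h2)

theorem knuth_insertWord {w : List ℕ} (hw : w.Nodup) :
    Knuth w (insertWord w).reverse.flatten := by
  induction w using List.reverseRecOn with
  | nil => exact Knuth.refl _
  | append_singleton w x ih =>
    have hn : w.Nodup := hw.sublist (List.sublist_append_left _ _)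
    have h := foldl_insertTab (w := w) (t := []) (by simp [IsTableau]) (by simpa using hn)
    rw [List.flatten_nil, List.append_nil] at h
    have h2 : insertWord (w ++ [x]) = insertTab (insertWord w) x := by simp [insertWord]
    rw [h2]
    refine ((ih hn).append_right [x]).trans (knuth_insertTab (fun r hr => (h.1.1 r hr).2) ?_)
    exact ((h.2.cons x).trans (List.perm_append_comm (l₁ := [x]))).nodup_iff.2 hw

theorem knuth_word_P (s : S) : Knuth s.1 (P s).word.1 := knuth_insertWord s.2.nodup

/-! ### Greene invariants -/

/-- Since `idxOf` returns the length for an absent letter, `b ∈ w` has to be required, while `a ∈ w`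
follows from the strict inequality. -/
theorem pair_sublist_iff {w : List ℕ} (hw : w.Nodup) {a b : ℕ} :
    [a, b].Sublist w ↔ b ∈ w ∧ w.idxOf a < w.idxOf b := by
  induction w with
  | nil => simp
  | cons c w ih =>
    rw [List.nodup_cons] at hw
    by_cases hac : a = c
    · subst hac
      rw [List.cons_sublist_cons, List.singleton_sublist]
      by_cases hb : b = a
      · subst hb
        simp [hw.1]
      · have : a ≠ b := fun h => hb h.symm
        simp [hb, List.idxOf_cons_ne _ this]
    · have hca : c ≠ a := fun h => hac h.symm
      have h1 : [a, b].Sublist (c :: w) ↔ [a, b].Sublist w := by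
        rw [List.sublist_cons_iff]
        simp [hac]
      rw [h1, ih hw.2]
      by_cases hb : b = c
      · subst hb
        simp [hw.1]
      · have : c ≠ b := fun h => hb h.symm
        simp [hb, List.idxOf_cons_ne _ this, List.idxOf_cons_ne _ hca]

/-- Exchange of the tails of two increasing sequences. The functions `p` and `p'` give the positions
of the letters before and after an elementary Knuth transformation `y x z → y z x`, and the classes
of the colouring `c` of `E` are increasing subsequences. -/
theorem exists_coloring_of_exchange {α : Type*} [LinearOrder α] {p p' : α → ℤ} {Ω : Set α} {k : ℕ}
    {x y z : α} (hxy : x < y) (hyz : y < z) (hΩ : x ∈ Ω → z ∈ Ω → y ∈ Ω)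
    (hix : ∀ a ∈ Ω, p a = p x → a = x) (hiy : ∀ a ∈ Ω, p a = p y → a = y)
    (hiz : ∀ a ∈ Ω, p a = p z → a = z) (hx : p x = p y + 1) (hz : p z = p y + 2)
    (hx' : p' x = p z) (hz' : p' z = p x) (hp' : ∀ a, a ≠ x → a ≠ z → p' a = p a)
    (E : Finset α) (c : α → ℕ) (hE : ∀ a ∈ E, a ∈ Ω) (hc : ∀ a ∈ E, c a < k)
    (h : ∀ a ∈ E, ∀ b ∈ E, a < b → c a = c b → p a < p b) :
    ∃ (E' : Finset α) (c' : α → ℕ), (∀ a ∈ E', a ∈ Ω) ∧ (∀ a ∈ E', c' a < k) ∧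
      (∀ a ∈ E', ∀ b ∈ E', a < b → c' a = c' b → p' a < p' b) ∧ E'.card = E.card := by
  have hxz := hxy.trans hyz
  have hpy : p' y = p y := hp' y hxy.ne' hyz.ne
  -- `x` and `z` are adjacent, so their pair is the only one whose relative order changes. The
  -- colouring can fail only if `x` and `z` share a colour.
  have key : ∀ a ∈ Ω, ∀ b ∈ Ω, p a < p b → (a = x ∧ b = z) ∨ p' a < p' b := by
    intro a ha b hb hab
    have h1 := hix a ha
    have h2 := hiz a ha
    have h3 := hix b hb
    have h4 := hiz b hb
    by_cases hax : a = x
    · by_cases hbz : b = z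
      · exact Or.inl ⟨hax, hbz⟩
      · subst hax
        have hba : b ≠ a := fun h => by rw [h] at hab; omega
        right
        have : p b ≠ p z := fun h => hbz (h4 h)
        rw [hp' b hba hbz]
        omega
    · right
      have ha1 : p a ≠ p x := fun h => hax (h1 h)
      by_cases haz : a = z
      · subst haz
        have hbx : b ≠ x := fun h => by rw [h] at hab; omega
        have hbz : b ≠ a := fun h => by rw [h] at hab; omega
        rw [hp' b hbx hbz]
        omega
      · have ha2 : p a ≠ p z := fun h => haz (h2 h)
        rw [hp' a hax haz]
        by_cases hbx : b = x
        · subst hbx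
          omega
        · by_cases hbz : b = z
          · subst hbz
            omega
          · rwa [hp' b hbx hbz]
  by_cases hE' : x ∈ E ∧ z ∈ E ∧ c x = c z
  · obtain ⟨hxE, hzE, hcxz⟩ := hE'
    have hyΩ := hΩ (hE x hxE) (hE z hzE)
    by_cases hyE : y ∈ E
    · have hcxy : c x ≠ c y := fun hcon => by
        have := h x hxE y hyE hxy hcon
        omega
      -- The class of `x` and `z` and the class of `y` are cut after the value `y` and exchange
      -- their upper parts. `cross` checks the two junctions, using that `y`, `x`, `z` occupy
      -- consecutive positions.
      have cross : ∀ a ∈ E, ∀ b ∈ E, a ≤ y → y < b → c a = Equiv.swap (c x) (c y) (c b) →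
          p' a < p' b := by
        intro a ha b hb hay hyb hab
        by_cases hb1 : c b = c x
        · rw [hb1, Equiv.swap_apply_left] at hab
          have hpb : p x < p b := h x hxE b hb (hxy.trans hyb) hb1.symm
          have hpa : p a ≤ p y := by
            rcases hay.lt_or_eq with h1 | h1
            · exact (h a ha y hyE h1 hab).le
            · rw [h1]
          refine (key a (hE a ha) b (hE b hb) (by omega)).resolve_left ?_
          rintro ⟨rfl, rfl⟩
          exact hcxy hab
        · by_cases hb2 : c b = c y
          · rw [hb2, Equiv.swap_apply_right] at hab
            have hpb : p y < p b := h y hyE b hb hyb hb2.symm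
            have hpa : p a < p z := h a ha z hzE (hay.trans_lt hyz) (hab.trans hcxz)
            have hpax : p a ≠ p y := fun hcon => by
              rw [hiy a (hE a ha) hcon] at hab
              exact hcxy hab.symm
            have hbx : b ≠ x := fun hcon => hb1 (by rw [hcon])
            have hbz : b ≠ z := fun hcon => hb1 (by rw [hcon, hcxz])
            have hpbx : p b ≠ p x := fun hcon => hbx (hix b (hE b hb) hcon)
            refine (key a (hE a ha) b (hE b hb) (by omega)).resolve_left ?_
            rintro ⟨-, rfl⟩
            exact hbz rfl
          · rw [Equiv.swap_apply_of_ne_of_ne hb1 hb2] at hab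
            refine (key a (hE a ha) b (hE b hb)
              (h a ha b hb (hay.trans_lt hyb) hab)).resolve_left ?_
            rintro ⟨rfl, rfl⟩
            exact hb1 hab.symm
      refine ⟨E, fun a => if y < a then Equiv.swap (c x) (c y) (c a) else c a, hE, ?_, ?_, rfl⟩
      · intro a ha
        dsimp only
        split_ifs
        · rw [Equiv.swap_apply_def]
          split_ifs
          · exact hc y hyE
          · exact hc x hxE
          · exact hc a ha
        · exact hc a ha
      · intro a ha b hb hab hcab
        dsimp only at hcab
        by_cases hya : y < a
        · rw [if_pos hya, if_pos (hya.trans hab)] at hcab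
          refine (key a (hE a ha) b (hE b hb) (h a ha b hb hab
            ((Equiv.swap (c x) (c y)).injective hcab))).resolve_left ?_
          rintro ⟨rfl, -⟩
          exact lt_asymm hxy hya
        · rw [if_neg hya] at hcab
          by_cases hyb : y < b
          · rw [if_pos hyb] at hcab
            exact cross a ha b hb (not_lt.1 hya) hyb hcab
          · rw [if_neg hyb] at hcab
            refine (key a (hE a ha) b (hE b hb) (h a ha b hb hab hcab)).resolve_left ?_
            rintro ⟨-, rfl⟩
            exact hyb hyz
    -- If `y` is unused, it replaces `x` in its class: it stands immediately before `x`, and it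
    -- remains before `z` after the move.
    · have hmem : ∀ a ∈ insert y (E.erase x), a = y ∨ (a ∈ E ∧ a ≠ x ∧ a ≠ y) := by
        intro a ha
        by_cases hay : a = y
        · exact Or.inl hay
        · simp only [Finset.mem_insert, Finset.mem_erase, hay, false_or] at ha
          exact Or.inr ⟨ha.2, ha.1, hay⟩
      refine ⟨insert y (E.erase x), Function.update c y (c x), ?_, ?_, ?_, ?_⟩
      · intro a ha
        rcases hmem a ha with rfl | ⟨ha, -, -⟩
        · exact hyΩ
        · exact hE a ha
      · intro a ha
        rcases hmem a ha with rfl | ⟨ha, -, hay⟩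
        · simpa using hc x hxE
        · rw [Function.update_of_ne hay]
          exact hc a ha
      · intro a ha b hb hab hcab
        rcases hmem a ha with rfl | ⟨haE, hax, hay⟩
        · rcases hmem b hb with rfl | ⟨hbE, hbx, hby⟩
          · exact absurd hab (lt_irrefl _)
          · rw [Function.update_self, Function.update_of_ne hby] at hcab
            have := h x hxE b hbE (hxy.trans hab) hcab
            rw [hpy]
            by_cases hbz : b = z
            · subst hbz
              omega
            · rw [hp' b hbx hbz]
              omega
        · rw [Function.update_of_ne hay] at hcab
          rcases hmem b hb with rfl | ⟨hbE, hbx, hby⟩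
          · rw [Function.update_self] at hcab
            have h1 := h a haE z hzE (hab.trans hyz) (hcab.trans hcxz)
            have h2 : p a ≠ p x := fun hcon => hax (hix a (hE a haE) hcon)
            have h3 : p a ≠ p b := fun hcon => hay (hiy a (hE a haE) hcon)
            rw [hpy, hp' a hax (hab.trans hyz).ne]
            omega
          · rw [Function.update_of_ne hby] at hcab
            exact (key a (hE a haE) b (hE b hbE) (h a haE b hbE hab hcab)).resolve_left
              fun hcon => hax hcon.1
      · rw [Finset.card_insert_of_notMem (by simp [hyE]), Finset.card_erase_add_one hxE]
  · refine ⟨E, c, hE, hc, fun a ha b hb hab hcab => ?_, rfl⟩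
    refine (key a (hE a ha) b (hE b hb) (h a ha b hb hab hcab)).resolve_left ?_
    rintro ⟨rfl, rfl⟩
    exact hE' ⟨ha, hb, hcab⟩

/-- The analogue of `exists_coloring_of_exchange` for the transformation `x z y → z x y`. -/
theorem exists_coloring_of_exchange_dual {α : Type*} [LinearOrder α] {p p' : α → ℤ} {Ω : Set α}
    {k : ℕ} {x y z : α} (hxy : x < y) (hyz : y < z) (hΩ : x ∈ Ω → z ∈ Ω → y ∈ Ω)
    (hix : ∀ a ∈ Ω, p a = p x → a = x) (hiy : ∀ a ∈ Ω, p a = p y → a = y)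
    (hiz : ∀ a ∈ Ω, p a = p z → a = z) (hz : p z = p x + 1) (hy : p y = p x + 2)
    (hx' : p' x = p z) (hz' : p' z = p x) (hp' : ∀ a, a ≠ x → a ≠ z → p' a = p a)
    (E : Finset α) (c : α → ℕ) (hE : ∀ a ∈ E, a ∈ Ω) (hc : ∀ a ∈ E, c a < k)
    (h : ∀ a ∈ E, ∀ b ∈ E, a < b → c a = c b → p a < p b) :
    ∃ (E' : Finset α) (c' : α → ℕ), (∀ a ∈ E', a ∈ Ω) ∧ (∀ a ∈ E', c' a < k) ∧
      (∀ a ∈ E', ∀ b ∈ E', a < b → c' a = c' b → p' a < p' b) ∧ E'.card = E.card := by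
  -- Reversing both the order of the letters and the positions turns one move into the other, with
  -- `x` and `z` interchanged. Positions are integers so that they can be negated.
  obtain ⟨E', c', a1, a2, a3, a4⟩ := exists_coloring_of_exchange (α := αᵒᵈ)
    (p := fun a => -p a) (p' := fun a => -p' a) (Ω := Ω) (x := z) (y := y) (z := x) hyz hxy
    (fun h1 h2 => hΩ h2 h1) (fun a ha h => hiz a ha (neg_injective h))
    (fun a ha h => hiy a ha (neg_injective h)) (fun a ha h => hix a ha (neg_injective h))
    (by omega) (by omega) (congrArg Neg.neg hz') (congrArg Neg.neg hx')
    (fun a h1 h2 => congrArg Neg.neg (hp' a h2 h1)) E c hE hc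
    (fun a ha b hb hab hcab => neg_lt_neg (h b hb a ha hab hcab.symm))
  exact ⟨E', c', a1, a2, fun a ha b hb hab hcab => neg_lt_neg_iff.1 (a3 b hb a ha hab hcab.symm),
    a4⟩

/-- There are `k` disjoint increasing subsequences of `w`, of total length `m`, whose letters are at
most `j`. -/
def Attains (w : List ℕ) (j k m : ℕ) : Prop :=
  ∃ (E : Finset ℕ) (c : ℕ → ℕ), (∀ a ∈ E, a ∈ w ∧ a ≤ j) ∧ (∀ a ∈ E, c a < k) ∧
    (∀ a ∈ E, ∀ b ∈ E, a < b → c a = c b → w.idxOf a < w.idxOf b) ∧ E.card = m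

theorem idxOf_swap {l r : List ℕ} {x z : ℕ} (h : (l ++ x :: z :: r).Nodup) :
    (l ++ x :: z :: r).idxOf x = l.length ∧ (l ++ x :: z :: r).idxOf z = l.length + 1 ∧
    (l ++ z :: x :: r).idxOf z = l.length ∧ (l ++ z :: x :: r).idxOf x = l.length + 1 ∧
    ∀ a, a ≠ x → a ≠ z → (l ++ z :: x :: r).idxOf a = (l ++ x :: z :: r).idxOf a := by
  have hxl : x ∉ l := fun hx => (List.nodup_append'.1 h).2.2 hx (by simp)
  have hzl : z ∉ l := fun hx => (List.nodup_append'.1 h).2.2 hx (by simp)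
  have hxz : x ≠ z := by
    rintro rfl
    simpa using (List.nodup_append'.1 h).2.1
  refine ⟨?_, ?_, ?_, ?_, ?_⟩
  · simp [List.idxOf_append_of_notMem hxl]
  · simp [List.idxOf_append_of_notMem hzl, List.idxOf_cons_ne _ hxz]
  · simp [List.idxOf_append_of_notMem hzl]
  · simp [List.idxOf_append_of_notMem hxl, List.idxOf_cons_ne _ hxz.symm]
  · intro a hax haz
    by_cases hal : a ∈ l
    · rw [List.idxOf_append_of_mem hal, List.idxOf_append_of_mem hal]
    · simp [List.idxOf_append_of_notMem hal, List.idxOf_cons_ne _ hax.symm,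
        List.idxOf_cons_ne _ haz.symm]

theorem Attains.step {v w : List ℕ} {j k m : ℕ} (hv : v.Nodup) (hs : KnuthStep v w)
    (h : Attains v j k m) : Attains w j k m := by
  obtain ⟨E, c, hE, hc, h, rfl⟩ := h
  cases hs with
  | @left l r x y z hxy hyz =>
    obtain ⟨h1, h2, h3, h4, h5⟩ := idxOf_swap (l := l ++ [y]) (r := r) (by simpa using hv)
    have h6 := (idxOf_swap (l := l) (r := z :: r) hv).1
    simp only [List.append_assoc, List.singleton_append, List.length_append,
      List.length_singleton] at h1 h2 h3 h4 h5
    have hi : ∀ b ∈ l ++ y :: x :: z :: r,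
        ∀ a ∈ {a | a ∈ l ++ y :: x :: z :: r ∧ a ≤ j},
        ((l ++ y :: x :: z :: r).idxOf a : ℤ) = (l ++ y :: x :: z :: r).idxOf b → a = b :=
      fun b _ a ha hab => (List.idxOf_inj ha.1).1 (by exact_mod_cast hab)
    obtain ⟨E', c', a1, a2, a3, a4⟩ := exists_coloring_of_exchange
      (p := fun a => ((l ++ y :: x :: z :: r).idxOf a : ℤ))
      (p' := fun a => ((l ++ y :: z :: x :: r).idxOf a : ℤ))
      (Ω := {a | a ∈ l ++ y :: x :: z :: r ∧ a ≤ j}) hxy hyz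
      (fun hx hz => ⟨by simp, hyz.le.trans hz.2⟩) (hi x (by simp)) (hi y (by simp))
      (hi z (by simp)) (by omega) (by omega) (by omega)
      (by omega) (fun a ha ha' => by have := h5 a ha ha'; omega) E c hE hc
      (fun a ha b hb hab hcab => by exact_mod_cast h a ha b hb hab hcab)
    refine ⟨E', c', fun a ha => ⟨?_, (a1 a ha).2⟩, a2,
      fun a ha b hb hab hcab => by exact_mod_cast a3 a ha b hb hab hcab, a4⟩
    exact (Knuth.of_step (KnuthStep.left l r hxy hyz)).perm.subset (a1 a ha).1
  | @right l r x y z hxy hyz =>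
    obtain ⟨h1, h2, h3, h4, h5⟩ := idxOf_swap (l := l) (r := y :: r) (by simpa using hv)
    have h6 := (idxOf_swap (l := l ++ [x]) (r := r) (x := z) (z := y) (by simpa using hv)).2.1
    simp only [List.append_assoc, List.singleton_append, List.length_append,
      List.length_singleton] at h6
    have hi : ∀ b ∈ l ++ x :: z :: y :: r,
        ∀ a ∈ {a | a ∈ l ++ x :: z :: y :: r ∧ a ≤ j},
        ((l ++ x :: z :: y :: r).idxOf a : ℤ) = (l ++ x :: z :: y :: r).idxOf b → a = b :=
      fun b _ a ha hab => (List.idxOf_inj ha.1).1 (by exact_mod_cast hab)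
    obtain ⟨E', c', a1, a2, a3, a4⟩ := exists_coloring_of_exchange_dual
      (p := fun a => ((l ++ x :: z :: y :: r).idxOf a : ℤ))
      (p' := fun a => ((l ++ z :: x :: y :: r).idxOf a : ℤ))
      (Ω := {a | a ∈ l ++ x :: z :: y :: r ∧ a ≤ j}) hxy hyz
      (fun hx hz => ⟨by simp, hyz.le.trans hz.2⟩) (hi x (by simp)) (hi y (by simp))
      (hi z (by simp)) (by omega) (by omega) (by omega)
      (by omega) (fun a ha ha' => by have := h5 a ha ha'; omega) E c hE hc
      (fun a ha b hb hab hcab => by exact_mod_cast h a ha b hb hab hcab)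
    refine ⟨E', c', fun a ha => ⟨?_, (a1 a ha).2⟩, a2,
      fun a ha b hb hab hcab => by exact_mod_cast a3 a ha b hb hab hcab, a4⟩
    exact (Knuth.of_step (KnuthStep.right l r hxy hyz)).perm.subset (a1 a ha).1

/-- Exchanging adjacent letters `x < z` only creates the inversion `(z, x)`. Both kinds of
`KnuthStep` are of this form, so each goes up in the weak order. -/
theorem inversion_swap {l r : List ℕ} {x z : ℕ} (h : (l ++ x :: z :: r).Nodup) (hxz : x < z)
    {a b : ℕ} (hab : a < b) (hb : [b, a].Sublist (l ++ x :: z :: r)) :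
    [b, a].Sublist (l ++ z :: x :: r) := by
  have hp : (l ++ x :: z :: r).Perm (l ++ z :: x :: r) := (List.Perm.swap _ _ _).append_left l
  obtain ⟨h1, h2, h3, h4, h5⟩ := idxOf_swap h
  rw [pair_sublist_iff h] at hb
  rw [pair_sublist_iff (hp.nodup_iff.1 h)]
  refine ⟨hp.subset hb.1, ?_⟩
  have hbm : b ∈ l ++ x :: z :: r := List.idxOf_lt_length_iff.1
    (hb.2.trans (List.idxOf_lt_length_iff.2 hb.1))
  have hi := fun c => List.idxOf_inj (l := l ++ x :: z :: r) (y := c) hb.1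
  have hj := fun c => List.idxOf_inj (l := l ++ x :: z :: r) (y := c) hbm
  have ha1 := hi x
  have ha2 := hi z
  have hb1 := hj x
  have hb2 := hj z
  have ha3 := h5 a
  have hb3 := h5 b
  by_cases c1 : a = x
  · subst c1
    by_cases c3 : b = z
    · subst c3; omega
    · have := hb3 hab.ne' c3; omega
  · by_cases c2 : a = z
    · subst c2
      by_cases c3 : b = x
      · omega
      · have := hb3 c3 hab.ne'; omega
    · rw [ha3 c1 c2]
      by_cases c3 : b = x
      · subst c3; omega
      · by_cases c4 : b = z
        · subst c4; omega
        · rw [hb3 c3 c4]; exact hb.2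

/-- If every inversion of `v` is an inversion of `w`, the increasing subsequences of `w` are
increasing subsequences of `v`. -/
theorem Attains.mono {v w : List ℕ} {j k m : ℕ} (hv : v.Nodup) (hw : w.Nodup) (hp : v.Perm w)
    (hi : ∀ a b, a < b → [b, a].Sublist v → [b, a].Sublist w) (h : Attains w j k m) :
    Attains v j k m := by
  obtain ⟨E, c, hE, hc, h, rfl⟩ := h
  refine ⟨E, c, fun a ha => ⟨hp.symm.subset (hE a ha).1, (hE a ha).2⟩, hc, ?_, rfl⟩
  intro a ha b hb hab hcab
  have h1 := h a ha b hb hab hcab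
  by_contra hcon
  have hav := hp.symm.subset (hE a ha).1
  have hne : v.idxOf b ≠ v.idxOf a :=
    fun heq => hab.ne' ((List.idxOf_inj (hp.symm.subset (hE b hb).1)).1 heq)
  have := (pair_sublist_iff hw).1 (hi a b hab ((pair_sublist_iff hv).2 ⟨hav, by omega⟩))
  omega

/-- For a single step, only the passage from `v` to `w` needs the exchange of tails. The way back
loses an inversion, so increasing subsequences stay increasing. -/
theorem Knuth.attains_iff {v w : List ℕ} {j k m : ℕ} (hv : v.Nodup) (h : Knuth v w) :
    Attains v j k m ↔ Attains w j k m := by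
  induction h with
  | rel v w hs =>
    have hp := (Knuth.of_step hs).perm
    have hw := hp.nodup_iff.1 hv
    refine ⟨Attains.step hv hs, Attains.mono hv hw hp ?_⟩
    intro a b hab hb
    cases hs with
    | @left l r x y z hxy hyz =>
      simpa using inversion_swap (l := l ++ [y]) (r := r) (by simpa using hv) (hxy.trans hyz) hab
        (by simpa using hb)
    | @right l r x y z hxy hyz => exact inversion_swap hv (hxy.trans hyz) hab hb
  | refl => rfl
  | symm v w h ih => exact (ih ((Knuth.perm h).nodup_iff.2 hv)).symm
  | trans u v w h _ ih ih' => exact (ih hv).trans (ih' ((Knuth.perm h).nodup_iff.1 hv))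

/-! ### Cells of a tableau and Greene's theorem for its reading word -/

/-- The entry of `t` in row `i` and column `j` is `a`. -/
def IsCell (t : List (List ℕ)) (i j a : ℕ) : Prop := (t.getD i [])[j]? = some a

theorem isCell_zero {r : List ℕ} {t : List (List ℕ)} {j a : ℕ} :
    IsCell (r :: t) 0 j a ↔ r[j]? = some a := by simp [IsCell]

theorem isCell_succ {r : List ℕ} {t : List (List ℕ)} {i j a : ℕ} :
    IsCell (r :: t) (i + 1) j a ↔ IsCell t i j a := by simp [IsCell]

theorem not_isCell_nil {i j a : ℕ} : ¬ IsCell [] i j a := by simp [IsCell]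

theorem exists_isCell {t : List (List ℕ)} {k a : ℕ} (h : a ∈ (t.take k).flatten) :
    ∃ i j, i < k ∧ IsCell t i j a := by
  induction t generalizing k with
  | nil => simp at h
  | cons r t ih =>
    cases k with
    | zero => simp at h
    | succ k =>
      rw [List.take_succ_cons, List.flatten_cons, List.mem_append] at h
      rcases h with h | h
      · obtain ⟨j, hj⟩ := List.mem_iff_getElem?.1 h
        exact ⟨0, j, by omega, isCell_zero.2 hj⟩
      · obtain ⟨i, j, hi, hij⟩ := ih h
        exact ⟨i + 1, j, by omega, isCell_succ.2 hij⟩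

theorem IsCell.mem_take {t : List (List ℕ)} {i j a k : ℕ} (h : IsCell t i j a) (hi : i < k) :
    a ∈ (t.take k).flatten := by
  induction t generalizing i k with
  | nil => exact absurd h not_isCell_nil
  | cons r t ih =>
    obtain ⟨k, rfl⟩ : ∃ k', k = k' + 1 := ⟨k - 1, by omega⟩
    rw [List.take_succ_cons, List.flatten_cons, List.mem_append]
    cases i with
    | zero => exact Or.inl (List.mem_of_getElem? (isCell_zero.1 h))
    | succ i => exact Or.inr (ih (isCell_succ.1 h) (by omega))

theorem IsCell.mem {t : List (List ℕ)} {i j a : ℕ} (h : IsCell t i j a) : a ∈ t.flatten := by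
  have h1 := h.mem_take (Nat.lt_succ_self i)
  obtain ⟨r, hr, ha⟩ := List.mem_flatten.1 h1
  exact List.mem_flatten.2 ⟨r, List.mem_of_mem_take hr, ha⟩

theorem IsCell.unique {t : List (List ℕ)} (hn : t.flatten.Nodup) {i j i' j' a : ℕ}
    (h : IsCell t i j a) (h' : IsCell t i' j' a) : i = i' ∧ j = j' := by
  induction t generalizing i i' with
  | nil => exact absurd h not_isCell_nil
  | cons r t ih =>
    rw [List.flatten_cons, List.nodup_append'] at hn
    cases i with
    | zero =>
      rw [isCell_zero] at h
      cases i' with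
      | zero =>
        rw [isCell_zero] at h'
        refine ⟨rfl, ?_⟩
        have hj : j < r.length := (List.getElem?_eq_some_iff.1 h).1
        exact (List.getElem?_inj hj hn.1).1 (h.trans h'.symm)
      | succ i' => exact absurd (isCell_succ.1 h').mem (hn.2.2 (List.mem_of_getElem? h))
    | succ i =>
      rw [isCell_succ] at h
      cases i' with
      | zero => exact absurd h.mem (hn.2.2 (List.mem_of_getElem? (isCell_zero.1 h')))
      | succ i' =>
        obtain ⟨rfl, rfl⟩ := ih hn.2.1 h (isCell_succ.1 h')
        exact ⟨rfl, rfl⟩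

theorem Below.getElem? {r s : List ℕ} (h : Below r s) {j b : ℕ} (hb : s[j]? = some b) :
    ∃ a, r[j]? = some a ∧ a < b := by
  induction r generalizing s j with
  | nil =>
    cases s with
    | nil => simp at hb
    | cons c s => exact h.elim
  | cons a r ih =>
    cases s with
    | nil => simp at hb
    | cons c s =>
      cases j with
      | zero =>
        simp only [List.getElem?_cons_zero, Option.some.injEq] at hb ⊢
        exact ⟨a, rfl, hb ▸ h.1⟩
      | succ j =>
        simp only [List.getElem?_cons_succ] at hb ⊢
        exact ih h.2 hb

theorem IsCell.pred {t : List (List ℕ)} (ht : t.IsChain Below) {i j b : ℕ}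
    (h : IsCell t (i + 1) j b) : ∃ a, IsCell t i j a ∧ a < b := by
  induction t generalizing i with
  | nil => exact absurd h not_isCell_nil
  | cons r t ih =>
    rw [isCell_succ] at h
    cases i with
    | zero =>
      cases t with
      | nil => exact absurd h not_isCell_nil
      | cons s t =>
        rw [isCell_zero] at h
        obtain ⟨a, ha, hab⟩ := (List.isChain_cons_cons.1 ht).1.getElem? h
        exact ⟨a, isCell_zero.2 ha, hab⟩
    | succ i =>
      obtain ⟨a, ha, hab⟩ := ih ht.tail h
      exact ⟨a, isCell_succ.2 ha, hab⟩

theorem IsCell.above {t : List (List ℕ)} (ht : t.IsChain Below) {i i' j b : ℕ}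
    (h : IsCell t i' j b) (hi : i ≤ i') : ∃ a, IsCell t i j a ∧ a ≤ b := by
  induction i' generalizing b with
  | zero =>
    obtain rfl : i = 0 := by omega
    exact ⟨b, h, le_rfl⟩
  | succ i' ih =>
    rcases hi.lt_or_eq with h1 | rfl
    · obtain ⟨c, hc, hcb⟩ := h.pred ht
      obtain ⟨a, ha, hac⟩ := ih hc (by omega)
      exact ⟨a, ha, by omega⟩
    · exact ⟨b, h, le_rfl⟩

theorem IsCell.lt {t : List (List ℕ)} (ht : t.IsChain Below) {i i' j a b : ℕ}
    (h : IsCell t i j a) (h' : IsCell t i' j b) (hi : i < i') : a < b := by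
  obtain ⟨i', rfl⟩ : ∃ k, i' = k + 1 := ⟨i' - 1, by omega⟩
  obtain ⟨c, hc, hcb⟩ := h'.pred ht
  obtain ⟨d, hd, hdc⟩ := hc.above ht (Nat.le_of_lt_succ hi)
  have : a = d := Option.some_injective _ (h.symm.trans hd)
  omega

theorem IsCell.sublist {t : List (List ℕ)} {i i' j j' a b : ℕ}
    (h : IsCell t i j a) (h' : IsCell t i' j' b) (hi : i < i') :
    [b, a].Sublist t.reverse.flatten := by
  induction t generalizing i i' with
  | nil => exact absurd h not_isCell_nil
  | cons r t ih =>
    obtain ⟨i', rfl⟩ : ∃ k, i' = k + 1 := ⟨i' - 1, by omega⟩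
    rw [List.reverse_cons, List.flatten_append, List.flatten_singleton]
    rw [isCell_succ] at h'
    cases i with
    | zero =>
      rw [isCell_zero] at h
      have h1 : b ∈ t.reverse.flatten := (List.reverse_perm t).flatten.symm.subset h'.mem
      exact List.Sublist.append (List.singleton_sublist.2 h1)
        (List.singleton_sublist.2 (List.mem_of_getElem? h))
    | succ i =>
      exact (ih (isCell_succ.1 h) h' (by omega)).trans (List.sublist_append_left _ _)

theorem pair_sublist_of_sorted {r : List ℕ} (hr : r.Pairwise (· < ·)) {a b : ℕ} (ha : a ∈ r)
    (hb : b ∈ r) (hab : a < b) : [a, b].Sublist r := by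
  induction r with
  | nil => simp at ha
  | cons c r ih =>
    rw [List.pairwise_cons] at hr
    rcases List.mem_cons.1 ha with rfl | har
    · rcases List.mem_cons.1 hb with rfl | hbr
      · omega
      · simpa using hbr
    · rcases List.mem_cons.1 hb with rfl | hbr
      · have := hr.1 a har
        omega
      · exact (ih hr.2 har hbr).cons _

/-- The entries of the first `k` rows of `t` that are at most `j`. -/
def entries (t : List (List ℕ)) (j k : ℕ) : Finset ℕ :=
  (t.take k).flatten.toFinset.filter (· ≤ j)

theorem mem_entries {t : List (List ℕ)} {j k a : ℕ} :
    a ∈ entries t j k ↔ a ∈ (t.take k).flatten ∧ a ≤ j := by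
  rw [entries, Finset.mem_filter, List.mem_toFinset]

/-- The rows themselves are disjoint increasing subsequences of the reading word; the colour of an
entry is its row. -/
theorem attains_entries {t : List (List ℕ)} (ht : IsTableau t) (hn : t.flatten.Nodup) (j k : ℕ) :
    Attains t.reverse.flatten j k (entries t j k).card := by
  have hp := (List.reverse_perm t).flatten
  have hcell : ∀ a ∈ entries t j k, ∃ i c, i < k ∧ IsCell t i c a :=
    fun a ha => exists_isCell (mem_entries.1 ha).1
  choose! row col hrow using hcell
  refine ⟨entries t j k, row, fun a ha => ⟨hp.symm.subset (hrow a ha).2.mem,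
    (mem_entries.1 ha).2⟩, fun a ha => (hrow a ha).1, ?_, rfl⟩
  intro a ha b hb hab hrab
  have h1 := (hrow a ha).2
  have h2 := (hrow b hb).2
  rw [← hrab] at h2
  have hmem : t.getD (row a) [] ∈ t := by
    have : row a < t.length := by
      by_contra hcon
      simp [IsCell, List.getElem?_eq_none (not_lt.1 hcon)] at h1
    simp [this]
  have hs := pair_sublist_of_sorted (ht.1 _ hmem).2 (List.mem_of_getElem? h1)
    (List.mem_of_getElem? h2) hab
  exact ((pair_sublist_iff (hp.nodup_iff.2 hn)).1 (hs.trans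
    (List.sublist_flatten_of_mem (List.mem_reverse.2 hmem)))).2

/-- Within a column, the entry of the later row is larger but is read earlier, so two entries of a
column never lie in the same increasing subsequence. Each column thus meets `E` in at most `k`
cells. Pushing these cells to the top of their column injects `E` into the first `k` rows, and
entries decrease on the way, so they stay at most `j`. -/
theorem Attains.le_card_entries {t : List (List ℕ)} (ht : t.IsChain Below) (hn : t.flatten.Nodup)
    {j k m : ℕ} (h : Attains t.reverse.flatten j k m) : m ≤ (entries t j k).card := by
  obtain ⟨E, c, hE, hc, h, rfl⟩ := h
  have hp := (List.reverse_perm t).flatten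
  have hcell : ∀ a ∈ E, ∃ i l, IsCell t i l a := fun a ha => by
    have h1 : a ∈ (t.take t.length).flatten := by
      rw [List.take_length]
      exact hp.subset (hE a ha).1
    obtain ⟨i, l, -, h2⟩ := exists_isCell h1
    exact ⟨i, l, h2⟩
  choose! row col hrow using hcell
  have hinj : ∀ a ∈ E, ∀ b ∈ E, col a = col b → row a = row b → a = b := by
    intro a ha b hb h1 h2
    have h3 := hrow a ha
    rw [h1, h2] at h3
    exact Option.some_injective _ (h3.symm.trans (hrow b hb))
  have hcol : ∀ a ∈ E, ∀ b ∈ E, col a = col b → row a < row b → c a ≠ c b := by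
    intro a ha b hb h1 h2 h3
    have h4 := hrow a ha
    rw [h1] at h4
    have h5 := h a ha b hb (h4.lt ht (hrow b hb) h2) h3
    have h6 := ((pair_sublist_iff (hp.nodup_iff.2 hn)).1 (h4.sublist (hrow b hb) h2)).2
    omega
  -- The number of elements of `E` above `e` in its column is the row to which `e` is pushed.
  let up : ℕ → Finset ℕ := fun e => E.filter fun a => col a = col e ∧ row a < row e
  have hup : ∀ e a, a ∈ up e ↔ a ∈ E ∧ col a = col e ∧ row a < row e := fun e a => by
    simp [up]
  have h1 : ∀ e ∈ E, (up e).card ≤ row e := by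
    intro e he
    rw [← Finset.card_range (row e)]
    refine Finset.card_le_card_of_injOn row (fun a ha => ?_) fun a ha b hb hab => ?_
    · simpa using ((hup e a).1 ha).2.2
    · have ha' := (hup e a).1 ha
      have hb' := (hup e b).1 hb
      exact hinj a ha'.1 b hb'.1 (ha'.2.1.trans hb'.2.1.symm) hab
  -- `e` and the elements of `up e` have pairwise distinct colours among `k`.
  have h2 : ∀ e ∈ E, (up e).card < k := by
    intro e he
    have heup : e ∉ up e := fun hcon => lt_irrefl _ ((hup e e).1 hcon).2.2
    rw [← Nat.succ_le_iff, Nat.succ_eq_add_one, ← Finset.card_insert_of_notMem heup]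
    have hins : ∀ a ∈ insert e (up e), a ∈ E ∧ col a = col e := by
      intro a ha
      rcases Finset.mem_insert.1 ha with rfl | ha
      · exact ⟨he, rfl⟩
      · exact ⟨((hup e a).1 ha).1, ((hup e a).1 ha).2.1⟩
    conv_rhs => rw [← Finset.card_range k]
    refine Finset.card_le_card_of_injOn c (fun a ha => ?_) fun a ha b hb hab => ?_
    · simpa using hc a (hins a ha).1
    · obtain ⟨ha, ha'⟩ := hins a ha
      obtain ⟨hb, hb'⟩ := hins b hb
      have hcab := ha'.trans hb'.symm
      rcases lt_trichotomy (row a) (row b) with h1 | h1 | h1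
      · exact absurd hab (hcol a ha b hb hcab h1)
      · exact hinj a ha b hb hcab h1
      · exact absurd hab.symm (hcol b hb a ha hcab.symm h1)
  have h3 : ∀ e ∈ E, ∃ a, IsCell t (up e).card (col e) a ∧ a ≤ e := fun e he =>
    (hrow e he).above ht (h1 e he)
  choose! φ hφ hφe using h3
  have h4 : ∀ a ∈ E, ∀ b ∈ E, col a = col b → row a < row b → (up a).card < (up b).card := by
    intro a ha b hb hcab hab
    apply Finset.card_lt_card
    rw [Finset.ssubset_iff_of_subset]
    · exact ⟨a, (hup b a).2 ⟨ha, hcab, hab⟩, fun hcon => lt_irrefl _ ((hup a a).1 hcon).2.2⟩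
    · intro d hd
      obtain ⟨hd1, hd2, hd3⟩ := (hup a d).1 hd
      exact (hup b d).2 ⟨hd1, hd2.trans hcab, hd3.trans hab⟩
  refine Finset.card_le_card_of_injOn φ (fun e he => ?_) fun a ha b hb hab => ?_
  · exact mem_entries.2 ⟨(hφ e he).mem_take (h2 e he), (hφe e he).trans (hE e he).2⟩
  · have h5 := hφ a ha
    rw [hab] at h5
    obtain ⟨h6, h7⟩ := h5.unique hn (hφ b hb)
    rcases lt_trichotomy (row a) (row b) with h1 | h1 | h1
    · have := h4 a ha b hb h7 h1
      omega
    · exact hinj a ha b hb h7 h1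
    · have := h4 b hb a ha h7.symm h1
      omega

theorem eq_of_mem_take_iff {t t' : List (List ℕ)} (h : ∀ r ∈ t, r ≠ [] ∧ r.Pairwise (· < ·))
    (h' : ∀ r ∈ t', r ≠ [] ∧ r.Pairwise (· < ·)) (hn : t.flatten.Nodup) (hn' : t'.flatten.Nodup)
    (hk : ∀ k a, a ∈ (t.take k).flatten ↔ a ∈ (t'.take k).flatten) : t = t' := by
  induction t generalizing t' with
  | nil =>
    cases t' with
    | nil => rfl
    | cons r t' =>
      obtain ⟨a, ha⟩ := List.exists_mem_of_ne_nil r (h' r (by simp)).1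
      have := hk 1 a
      simp [ha] at this
  | cons r t ih =>
    cases t' with
    | nil =>
      obtain ⟨a, ha⟩ := List.exists_mem_of_ne_nil r (h r (by simp)).1
      have := hk 1 a
      simp [ha] at this
    | cons r' t' =>
      have hr := (h r (by simp)).2
      have hr' := (h' r' (by simp)).2
      have hrr : r = r' := List.Perm.eq_of_pairwise' hr hr'
        ((List.perm_ext_iff_of_nodup (hr.imp ne_of_lt) (hr'.imp ne_of_lt)).2
          fun a => by simpa using hk 1 a)
      subst hrr
      rw [List.flatten_cons, List.nodup_append'] at hn hn'
      rw [ih (fun s hs => h s (by simp [hs])) (fun s hs => h' s (by simp [hs])) hn.2.1 hn'.2.1]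
      intro k a
      have h1 := hk (k + 1) a
      rw [List.take_succ_cons, List.take_succ_cons, List.flatten_cons, List.flatten_cons,
        List.mem_append, List.mem_append] at h1
      have h2 : ∀ t : List (List ℕ), a ∈ (t.take k).flatten → a ∈ t.flatten := fun t ha =>
        (List.Sublist.flatten (List.take_sublist k t)).subset ha
      constructor
      · intro ha
        exact (h1.1 (Or.inr ha)).resolve_left fun hr => hn.2.2 hr (h2 _ ha)
      · intro ha
        exact (h1.2 (Or.inr ha)).resolve_left fun hr => hn'.2.2 hr (h2 _ ha)

/-- An entry `a` lies in the first `k` rows exactly when the count jumps between `j = a - 1` and `j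
= a`. The value `a = 0` is treated apart because subtraction is truncated. -/
theorem eq_of_card_entries {t t' : List (List ℕ)} (h : ∀ r ∈ t, r ≠ [] ∧ r.Pairwise (· < ·))
    (h' : ∀ r ∈ t', r ≠ [] ∧ r.Pairwise (· < ·)) (hn : t.flatten.Nodup) (hn' : t'.flatten.Nodup)
    (hk : ∀ j k, (entries t j k).card = (entries t' j k).card) : t = t' := by
  have hmem : ∀ (t : List (List ℕ)) k a, a ∈ (t.take k).flatten ↔
      ((entries t a k).card ≠ if a = 0 then 0 else (entries t (a - 1) k).card) := by
    intro t k a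
    by_cases ha : a ∈ (t.take k).flatten
    · simp only [ha, true_iff]
      split_ifs with h0
      · exact Finset.card_ne_zero_of_mem (mem_entries.2 ⟨ha, le_rfl⟩)
      · apply ne_of_gt
        apply Finset.card_lt_card
        rw [Finset.ssubset_iff_of_subset]
        · exact ⟨a, mem_entries.2 ⟨ha, le_rfl⟩, fun hcon => by
            have := (mem_entries.1 hcon).2
            omega⟩
        · intro b hb
          have := mem_entries.1 hb
          exact mem_entries.2 ⟨this.1, by omega⟩
    · simp only [ha, false_iff, not_not]
      split_ifs with h0
      · rw [Finset.card_eq_zero, Finset.eq_empty_iff_forall_notMem]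
        intro b hb
        obtain ⟨hb, hb'⟩ := mem_entries.1 hb
        exact ha (by rwa [show a = b by omega])
      · congr 1
        ext b
        rw [mem_entries, mem_entries]
        refine and_congr_right fun hb => ?_
        have : b ≠ a := fun hcon => ha (hcon ▸ hb)
        omega
  exact eq_of_mem_take_iff h h' hn hn' fun k a => by rw [hmem, hmem, hk, hk]

/-! ### The plactic relation and the weak order on tableaux -/

theorem T.nodup (A : T) : A.1.flatten.Nodup := A.2.2.nodup

theorem T.attains_word (A : T) (j k : ℕ) : Attains A.word.1 j k (entries A.1 j k).card :=
  attains_entries A.2.1 A.nodup j k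

theorem T.ext_entries {A B : T} (h : ∀ j k, (entries A.1 j k).card = (entries B.1 j k).card) :
    A = B :=
  Subtype.ext (eq_of_card_entries A.2.1.1 B.2.1.1 A.nodup B.nodup h)

theorem le_card_entries_of_attains {A : T} {j k m : ℕ} (h : Attains A.word.1 j k m) :
    m ≤ (entries A.1 j k).card := Attains.le_card_entries A.2.1.2 A.nodup h

theorem Knuth.eq_of_word {A B : T} (h : Knuth A.word.1 B.word.1) : A = B :=
  T.ext_entries fun j k => le_antisymm
    (le_card_entries_of_attains ((h.attains_iff A.word.2.nodup).1 (A.attains_word j k)))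
    (le_card_entries_of_attains ((h.attains_iff A.word.2.nodup).2 (B.attains_word j k)))

theorem Knuth.P_eq {s t : S} (h : Knuth s.1 t.1) : P s = P t :=
  Knuth.eq_of_word (((knuth_word_P s).symm.trans h).trans (knuth_word_P t))

theorem P_word (A : T) : P A.word = A := Knuth.eq_of_word (knuth_word_P A.word).symm

theorem P_surjective : Function.Surjective P := fun A => ⟨A.word, P_word A⟩

theorem S.perm_of_size_eq {s t : S} (h : s.size = t.size) : s.1.Perm t.1 := by
  have h' : s.1.length = t.1.length := h
  have ht := t.2
  unfold IsPermWord at ht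
  rw [← h'] at ht
  exact s.2.trans ht.symm

/-- Going up adds inversions and so destroys increasing subsequences. Monotonicity of these counts
passes to the transitive closure, which makes antisymmetry accessible. -/
theorem T.weakLE.card_entries_le {A B : T} (h : A.weakLE B) (j k : ℕ) :
    (entries B.1 j k).card ≤ (entries A.1 j k).card := by
  induction h with
  | single h =>
    obtain ⟨u, v, rfl, rfl, h⟩ := h
    have h1 := ((knuth_word_P v).attains_iff v.2.nodup).2 ((P v).attains_word j k)
    have h2 := h1.mono u.2.nodup v.2.nodup (S.perm_of_size_eq h.1) h.2
    exact le_card_entries_of_attains (((knuth_word_P u).attains_iff u.2.nodup).1 h2)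
  | tail _ h ih =>
    obtain ⟨u, v, rfl, rfl, h⟩ := h
    have h1 := ((knuth_word_P v).attains_iff v.2.nodup).2 ((P v).attains_word j k)
    have h2 := h1.mono u.2.nodup v.2.nodup (S.perm_of_size_eq h.1) h.2
    exact (le_card_entries_of_attains (((knuth_word_P u).attains_iff u.2.nodup).1 h2)).trans ih

theorem T.weakLE.antisymm {A B : T} (h : A.weakLE B) (h' : B.weakLE A) : A = B :=
  T.ext_entries fun j k => le_antisymm (h'.card_entries_le j k) (h.card_entries_le j k)

theorem T.weakLE.refl (A : T) : A.weakLE A :=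
  Relation.TransGen.single ⟨A.word, A.word, P_word A, P_word A, rfl, fun _ _ _ h => h⟩

theorem T.weakLE.trans {A B C : T} (h : A.weakLE B) (h' : B.weakLE C) : A.weakLE C :=
  Relation.TransGen.trans h h'

/-! ### Restriction to intervals and the product `△` -/

theorem IsPermWord.mem_iff {w : List ℕ} (h : IsPermWord w) {a : ℕ} :
    a ∈ w ↔ 1 ≤ a ∧ a ≤ w.length := by
  rw [List.Perm.mem_iff h, List.mem_range'_1]
  omega

/-- The letters counted are exactly `i + 1, …, a`. Standardizing a restriction to an interval is
therefore subtraction of `i`. -/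
theorem IsPermWord.countP_filter_Icc {w : List ℕ} (h : IsPermWord w) {i m a : ℕ} (hia : i ≤ a)
    (ham : a ≤ m) (hm : m ≤ w.length) :
    (w.filter fun b => b ∈ Finset.Icc (i + 1) m).countP (fun b => b ≤ a) = a - i := by
  rw [List.countP_eq_length_filter, ← List.toFinset_card_of_nodup ((h.nodup.filter _).filter _)]
  have : ((w.filter fun b => b ∈ Finset.Icc (i + 1) m).filter fun b => b ≤ a).toFinset
      = Finset.Icc (i + 1) a := by
    ext b
    simp only [List.mem_toFinset, List.mem_filter, h.mem_iff, Finset.mem_Icc, decide_eq_true_eq]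
    omega
  rw [this, Nat.card_Icc]
  omega

theorem IsPermWord.length_filter_Icc {w : List ℕ} (h : IsPermWord w) {i m : ℕ} (him : i ≤ m)
    (hm : m ≤ w.length) : (w.filter fun b => b ∈ Finset.Icc (i + 1) m).length = m - i := by
  rw [← h.countP_filter_Icc him le_rfl hm, eq_comm, List.countP_eq_length]
  intro b hb
  simp only [List.mem_filter, Finset.mem_Icc, decide_eq_true_eq] at hb ⊢
  exact hb.2.2

theorem IsPermWord.st_filter_Icc {w : List ℕ} (h : IsPermWord w) {i m : ℕ} (hm : m ≤ w.length) :
    st (w.filter fun b => b ∈ Finset.Icc (i + 1) m)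
      = (w.filter fun b => b ∈ Finset.Icc (i + 1) m).map (· - i) := by
  unfold st
  refine List.map_congr_left fun a ha => ?_
  simp only [List.mem_filter, Finset.mem_Icc, decide_eq_true_eq] at ha
  exact h.countP_filter_Icc (by omega) ha.2.2 hm

theorem S.restr_low (s : S) {i : ℕ} (hi : i ≤ s.size) :
    (s.restr (Finset.Icc 1 i)).1 = s.1.filter fun a => a ∈ Finset.Icc 1 i := by
  have := s.2.st_filter_Icc (i := 0) hi
  simpa [S.restr] using this

theorem S.restr_high (s : S) (i : ℕ) :
    (s.restr (Finset.Icc (i + 1) s.size)).1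
      = (s.1.filter fun a => a ∈ Finset.Icc (i + 1) s.size).map (· - i) :=
  s.2.st_filter_Icc le_rfl

theorem S.size_restr (s : S) {i m : ℕ} (hi : i ≤ m) (hm : m ≤ s.size) :
    (s.restr (Finset.Icc (i + 1) m)).size = m - i := by
  have := s.2.length_filter_Icc hi hm
  unfold S.size S.restr st
  rwa [List.length_map]

theorem S.size_tri (v u : S) : (v.tri u).size = v.size + u.size := by
  simp [S.size, S.tri]

theorem S.restr_tri_low (v u : S) : (v.tri u).restr (Finset.Icc 1 u.size) = u := by
  apply Subtype.ext
  rw [S.restr_low _ (by rw [S.size_tri]; omega)]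
  change (v.1.map (fun a => a + u.1.length) ++ u.1).filter _ = _
  rw [List.filter_append, List.filter_eq_nil_iff.2, List.filter_eq_self.2, List.nil_append]
  · intro a ha
    simpa [S.size] using u.2.mem_iff.1 ha
  · intro a ha
    obtain ⟨b, hb, rfl⟩ := List.mem_map.1 ha
    have := v.2.mem_iff.1 hb
    simp [S.size]
    omega

theorem S.restr_tri_high (v u : S) :
    (v.tri u).restr (Finset.Icc (u.size + 1) (v.tri u).size) = v := by
  apply Subtype.ext
  rw [S.restr_high, S.size_tri]
  change ((v.1.map (fun a => a + u.1.length) ++ u.1).filter _).map _ = _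
  rw [List.filter_append, List.filter_eq_self.2, List.filter_eq_nil_iff.2, List.append_nil,
    List.map_map]
  · simp [S.size, Function.comp_def]
  · intro a ha
    have := u.2.mem_iff.1 ha
    simp [S.size]
    omega
  · intro a ha
    obtain ⟨b, hb, rfl⟩ := List.mem_map.1 ha
    have := v.2.mem_iff.1 hb
    simp [S.size]
    omega

/-! ### Inversions under relabelling, restriction and concatenation -/

theorem pair_sublist_map {f : ℕ → ℕ} {w : List ℕ} {j i : ℕ} :
    [j, i].Sublist (w.map f) ↔ ∃ b a, f b = j ∧ f a = i ∧ [b, a].Sublist w := by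
  rw [List.sublist_map_iff]
  constructor
  · rintro ⟨l, hl, h⟩
    match l, h with
    | [b, a], h =>
      simp only [List.map_cons, List.map_nil, List.cons.injEq, and_true] at h
      exact ⟨b, a, h.1.symm, h.2.symm, hl⟩
  · rintro ⟨b, a, rfl, rfl, h⟩
    exact ⟨[b, a], h, rfl⟩

theorem pair_sublist_filter {p : ℕ → Bool} {w : List ℕ} {j i : ℕ} :
    [j, i].Sublist (w.filter p) ↔ p j ∧ p i ∧ [j, i].Sublist w := by
  constructor
  · intro h
    refine ⟨(List.mem_filter.1 (h.subset (by simp))).2, (List.mem_filter.1 (h.subset (by simp))).2,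
      h.trans List.filter_sublist⟩
  · rintro ⟨h1, h2, h3⟩
    simpa [h1, h2] using h3.filter p

theorem pair_sublist_append {l r : List ℕ} {j i : ℕ} :
    [j, i].Sublist (l ++ r) ↔ [j, i].Sublist l ∨ [j, i].Sublist r ∨ (j ∈ l ∧ i ∈ r) := by
  constructor
  · intro h
    obtain ⟨l₁, l₂, h1, h2, h3⟩ := List.sublist_append_iff.1 h
    match l₁, h1 with
    | [], h1 =>
      rw [List.nil_append] at h1
      exact Or.inr (Or.inl (h1 ▸ h3))
    | [a], h1 =>
      simp only [List.cons_append, List.nil_append, List.cons.injEq] at h1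
      rw [← h1.1] at h2
      rw [← h1.2] at h3
      exact Or.inr (Or.inr ⟨List.singleton_sublist.1 h2, List.singleton_sublist.1 h3⟩)
    | [a, b], h1 =>
      simp only [List.cons_append, List.nil_append, List.cons.injEq] at h1
      rw [← h1.1, ← h1.2.1] at h2
      exact Or.inl h2
    | a :: b :: c :: d, h1 => simp at h1
  · rintro (h | h | ⟨h, h'⟩)
    · exact h.trans (List.sublist_append_left _ _)
    · exact h.trans (List.sublist_append_right _ _)
    · exact List.Sublist.append (List.singleton_sublist.2 h) (List.singleton_sublist.2 h')

theorem S.weakLE.restr {s t : S} (h : s.weakLE t) (I : Finset ℕ) :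
    (s.restr I).weakLE (t.restr I) := by
  have hp : (s.1.filter fun a => a ∈ I).Perm (t.1.filter fun a => a ∈ I) :=
    (S.perm_of_size_eq h.1).filter _
  refine ⟨?_, fun i j hij hji => ?_⟩
  · simpa [S.size, S.restr, st] using hp.length_eq
  · change [j, i].Sublist (st _) at hji
    change [j, i].Sublist (st _)
    rw [st_eq_map_of_perm hp]
    unfold st at hji
    rw [pair_sublist_map] at hji ⊢
    obtain ⟨b, a, rfl, rfl, hba⟩ := hji
    refine ⟨b, a, rfl, rfl, ?_⟩
    have hab : a < b := by
      by_contra hcon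
      rcases (not_lt.1 hcon).lt_or_eq with h1 | h1
      · exact lt_asymm hij (countP_le_lt_countP_le (hba.subset (by simp)) h1)
      · rw [h1] at hij
        exact lt_irrefl _ hij
    rw [pair_sublist_filter] at hba ⊢
    exact ⟨hba.1, hba.2.1, h.2 a b hab hba.2.2⟩

theorem S.weakLE.tri {v v' u u' : S} (hv : v.weakLE v') (hu : u.weakLE u') :
    (v.tri u).weakLE (v'.tri u') := by
  refine ⟨by rw [S.size_tri, S.size_tri, hv.1, hu.1], fun i j hij h => ?_⟩
  have hlen : u.1.length = u'.1.length := hu.1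
  change [j, i].Sublist (v.1.map (fun a => a + u.1.length) ++ u.1) at h
  change [j, i].Sublist (v'.1.map (fun a => a + u'.1.length) ++ u'.1)
  rw [pair_sublist_append] at h ⊢
  rw [← hlen]
  rcases h with h | h | ⟨h, h'⟩
  · left
    rw [pair_sublist_map] at h ⊢
    obtain ⟨b, a, rfl, rfl, h⟩ := h
    exact ⟨b, a, rfl, rfl, hv.2 a b (by omega) h⟩
  · exact Or.inr (Or.inl (hu.2 i j hij h))
  · refine Or.inr (Or.inr ⟨?_, (S.perm_of_size_eq hu.1).subset h'⟩)
    exact ((S.perm_of_size_eq hv.1).map _).subset h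

/-- Moving all letters larger than `i` in front of the others, without changing the order inside the
two groups, only adds inversions. This is the unit of the adjunction. -/
theorem S.weakLE_tri_restr (s : S) {i : ℕ} (hi : i ≤ s.size) :
    s.weakLE ((s.restr (Finset.Icc (i + 1) s.size)).tri (s.restr (Finset.Icc 1 i))) := by
  have hlow : (s.restr (Finset.Icc 1 i)).1.length = i := s.size_restr (i := 0) (by omega) hi
  refine ⟨?_, fun a b hab h => ?_⟩
  · rw [S.size_tri, s.size_restr hi le_rfl, s.size_restr (i := 0) (by omega) hi]
    omega
  · change [b, a].Sublist (List.map _ _ ++ _)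
    rw [hlow, S.restr_low _ hi, S.restr_high, List.map_map]
    have hb := s.2.mem_iff.1 (h.subset (show b ∈ [b, a] by simp))
    have ha := s.2.mem_iff.1 (h.subset (show a ∈ [b, a] by simp))
    have hsz : s.size = s.1.length := rfl
    rw [pair_sublist_append, pair_sublist_map, pair_sublist_filter]
    simp only [decide_eq_true_eq, Finset.mem_Icc, Function.comp_apply]
    by_cases hbi : b ≤ i
    · exact Or.inr (Or.inl ⟨by omega, by omega, h⟩)
    · by_cases hai : a ≤ i
      · refine Or.inr (Or.inr ⟨?_, ?_⟩)
        · refine List.mem_map.2 ⟨b, List.mem_filter.2 ⟨h.subset (by simp), ?_⟩, ?_⟩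
          · simp only [decide_eq_true_eq]
            omega
          · simp only [Function.comp_apply]
            omega
        · refine List.mem_filter.2 ⟨h.subset (by simp), ?_⟩
          simp only [decide_eq_true_eq]
          omega
      · refine Or.inl ⟨b, a, by omega, by omega, ?_⟩
        rw [pair_sublist_filter]
        simp only [decide_eq_true_eq]
        exact ⟨by omega, by omega, h⟩

theorem Knuth.restr {s t : S} (h : Knuth s.1 t.1) (a b : ℕ) :
    Knuth (s.restr (Finset.Icc a b)).1 (t.restr (Finset.Icc a b)).1 := by
  refine Knuth.st (h.filter fun x y z hxy hyz hx hz => ?_)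
  simp only [decide_eq_true_eq, Finset.mem_Icc] at hx hz ⊢
  omega

/-- Knuth equivalence is a congruence for concatenation and is preserved by shifting letters. -/
theorem P_tri (v u : S) : P (v.tri u) = (P v).tri (P u) := by
  apply Knuth.P_eq
  change Knuth (v.1.map (fun a => a + u.1.length) ++ u.1) (_ ++ _)
  have hlen := (knuth_word_P u).perm.length_eq
  rw [hlen]
  exact ((knuth_word_P v).map fun a _ b _ hab => by omega).append (knuth_word_P u)

theorem T.size_word (A : T) : A.word.size = A.size := by
  rw [← size_P, P_word]

/-- The tableau of the entries of `A` that are at most `i`. -/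
def T.low (A : T) (i : ℕ) : T := P (A.word.restr (Finset.Icc 1 i))

/-- The rectification of the skew tableau of the entries of `A` that are larger than `i`. -/
def T.high (A : T) (i : ℕ) : T := P (A.word.restr (Finset.Icc (i + 1) A.size))

theorem low_P (s : S) (i : ℕ) : (P s).low i = P (s.restr (Finset.Icc 1 i)) :=
  ((knuth_word_P s).symm.restr 1 i).P_eq

theorem high_P (s : S) (i : ℕ) : (P s).high i = P (s.restr (Finset.Icc (i + 1) s.size)) := by
  rw [T.high, size_P]
  exact ((knuth_word_P s).symm.restr _ _).P_eq

theorem T.size_low (A : T) {i : ℕ} (hi : i ≤ A.size) : (A.low i).size = i := by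
  rw [T.low, size_P, A.word.size_restr (i := 0) (by omega) (by rwa [A.size_word])]
  omega

theorem T.size_tri (V U : T) : (V.tri U).size = V.size + U.size := by
  rw [T.tri, size_P, S.size_tri, T.size_word, T.size_word]

theorem weakLE_P {s t : S} (h : s.weakLE t) : (P s).weakLE (P t) :=
  Relation.TransGen.single ⟨s, t, rfl, rfl, h⟩

theorem T.weakLE.low {A B : T} (h : A.weakLE B) (i : ℕ) : (A.low i).weakLE (B.low i) := by
  refine Relation.TransGen.lift (fun A : T => A.low i) ?_ _ _ h
  rintro _ _ ⟨u, v, rfl, rfl, h⟩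
  exact ⟨_, _, (low_P u i).symm, (low_P v i).symm, h.restr _⟩

theorem T.weakLE.high {A B : T} (h : A.weakLE B) (i : ℕ) : (A.high i).weakLE (B.high i) := by
  refine Relation.TransGen.lift (fun A : T => A.high i) ?_ _ _ h
  rintro _ _ ⟨u, v, rfl, rfl, h⟩
  refine ⟨_, _, (high_P u i).symm, (high_P v i).symm, ?_⟩
  rw [h.1]
  exact h.restr _

theorem S.weakLE.refl (s : S) : s.weakLE s := ⟨rfl, fun _ _ _ h => h⟩

theorem T.weakLE.tri {V V' U U' : T} (hV : V.weakLE V') (hU : U.weakLE U') :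
    (V.tri U).weakLE (V'.tri U') := by
  have h1 : (V.tri U).weakLE (V'.tri U) := by
    refine Relation.TransGen.lift (fun V : T => V.tri U) ?_ _ _ hV
    rintro _ _ ⟨u, v, rfl, rfl, h⟩
    refine ⟨u.tri U.word, v.tri U.word, ?_, ?_, h.tri (.refl _)⟩ <;> rw [P_tri, P_word]
  have h2 : (V'.tri U).weakLE (V'.tri U') := by
    refine Relation.TransGen.lift (fun U : T => V'.tri U) ?_ _ _ hU
    rintro _ _ ⟨u, v, rfl, rfl, h⟩
    refine ⟨V'.word.tri u, V'.word.tri v, ?_, ?_, S.weakLE.tri (.refl _) h⟩ <;> rw [P_tri, P_word]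
  exact h1.trans h2

theorem T.low_tri (V U : T) : (V.tri U).low U.size = U := by
  rw [T.tri, low_P, ← U.size_word, S.restr_tri_low, P_word]

theorem T.high_tri (V U : T) : (V.tri U).high U.size = V := by
  rw [T.tri, high_P, ← U.size_word, S.restr_tri_high, P_word]

theorem T.weakLE_tri (A : T) {i : ℕ} (hi : i ≤ A.size) :
    A.weakLE ((A.high i).tri (A.low i)) := by
  have h := weakLE_P (A.word.weakLE_tri_restr (i := i) (by rwa [A.size_word]))
  rwa [P_tri, ← low_P, ← high_P, P_word] at h

/-- A Galois connection: `low` and `high` are monotone and recover `U` and `V` from `V.tri U`;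
conversely `A` lies below the product of its own two parts, and `△` is monotone. -/
theorem T.weakLE_tri_iff {A V U : T} :
    A.weakLE (V.tri U) ↔
      U.size ≤ A.size ∧ (A.low U.size).weakLE U ∧ (A.high U.size).weakLE V := by
  constructor
  · intro h
    have h1 := h.size_eq
    rw [T.size_tri] at h1
    refine ⟨by omega, ?_, ?_⟩
    · simpa [T.low_tri] using h.low U.size
    · simpa [T.high_tri] using h.high U.size
  · rintro ⟨h1, h2, h3⟩
    exact (A.weakLE_tri h1).trans (h3.tri h2)

/-! ### The zeta transform of the weak order -/

theorem T.mem_above {A W : T} : W ∈ A.above ↔ A.weakLE W := by simp [T.above]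

/-- The measure for Möbius recursion. Strictness is where antisymmetry of the weak order is used. -/
theorem T.card_above_lt {A W : T} (h : A.weakLE W) (hne : W ≠ A) :
    W.above.card < A.above.card := by
  apply Finset.card_lt_card
  rw [Finset.ssubset_iff_of_subset]
  · exact ⟨A, T.mem_above.2 (.refl A), fun h' => hne ((T.mem_above.1 h').antisymm h)⟩
  · exact fun B hB => T.mem_above.2 (h.trans (T.mem_above.1 hB))

/-- The linear map sending a tableau to the sum of the tableaux above it. -/
noncomputable def zeta : ZT →ₗ[ℤ] ZT :=
  Finsupp.linearCombination ℤ fun A : T => ∑ W ∈ A.above, (Finsupp.single W 1 : ZT)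

theorem zeta_single (A : T) :
    zeta (Finsupp.single A 1) = ∑ W ∈ A.above, (Finsupp.single W 1 : ZT) := by
  rw [zeta, Finsupp.linearCombination_single, one_smul]

open Classical in
theorem zeta_single_apply (A B : T) :
    zeta (Finsupp.single A 1) B = if A.weakLE B then 1 else 0 := by
  rw [zeta_single, Finsupp.finsetSum_apply]
  simp [Finsupp.single_apply, T.mem_above]

open Classical in
theorem T.sum_above_eq {N : Type*} [AddCommMonoid N] (A : T) (f : T → N) :
    ∑ W ∈ A.above, f W = f A + ∑ W ∈ A.above.erase A, f W :=
  (Finset.add_sum_erase _ f (T.mem_above.2 (.refl A))).symm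

open Classical in
/-- The monomial basis, by Möbius inversion. -/
noncomputable def monomialBasis (A : T) : ZT :=
  Finsupp.single A 1 - ∑ W ∈ (A.above.erase A).attach, monomialBasis W.1
termination_by A.above.card
decreasing_by
  have h := Finset.mem_erase.1 W.2
  exact T.card_above_lt (T.mem_above.1 h.2) h.1

open Classical in
theorem monomialBasis_eq (A : T) :
    monomialBasis A = Finsupp.single A 1 - ∑ W ∈ A.above.erase A, monomialBasis W := by
  rw [monomialBasis, Finset.sum_attach _ monomialBasis]

theorem isMonomialBasis_monomialBasis : IsMonomialBasis monomialBasis := by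
  classical
  intro A
  rw [T.sum_above_eq, monomialBasis_eq, sub_add_cancel]

/-- The defining identities of `M` say precisely this on basis elements. Thus `zeta x A` is the
coefficient of `M A` in `x`, and `M` is forced to be the image of the standard basis under the
inverse of `zeta`. -/
theorem IsMonomialBasis.linearCombination_zeta {M : T → ZT} (hM : IsMonomialBasis M) (x : ZT) :
    Finsupp.linearCombination ℤ M (zeta x) = x := by
  have : (Finsupp.linearCombination ℤ M).comp zeta = LinearMap.id := by
    refine Finsupp.lhom_ext' fun A => LinearMap.ext_ring ?_
    simp only [LinearMap.comp_apply, Finsupp.lsingle_apply, LinearMap.id_apply]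
    rw [zeta_single, map_sum, hM A]
    simp
  exact LinearMap.congr_fun this x

/-- `zeta` is unitriangular with finite upper sets: the tableaux strictly above `A` are already in
the range by induction. -/
theorem single_mem_range_zeta (A : T) : Finsupp.single A 1 ∈ LinearMap.range zeta := by
  classical
  induction hn : A.above.card using Nat.strong_induction_on generalizing A with
  | _ n ih =>
    have h : (Finsupp.single A 1 : ZT)
        = zeta (Finsupp.single A 1) - ∑ W ∈ A.above.erase A, Finsupp.single W 1 := by
      rw [zeta_single, T.sum_above_eq, add_sub_cancel_right]
    rw [h]
    refine sub_mem ⟨_, rfl⟩ (sum_mem fun W hW => ?_)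
    rw [Finset.mem_erase, T.mem_above] at hW
    exact ih _ (hn ▸ T.card_above_lt hW.2 hW.1) W rfl

theorem zeta_bijective : Function.Bijective zeta := by
  refine ⟨Function.LeftInverse.injective
    isMonomialBasis_monomialBasis.linearCombination_zeta, ?_⟩
  rw [← LinearMap.range_eq_top, eq_top_iff, ← Finsupp.span_single_eq_top]
  rw [Submodule.span_le]
  rintro _ ⟨A, c, rfl⟩
  change Finsupp.single A c ∈ _
  rw [← mul_one c, ← smul_eq_mul, ← Finsupp.smul_single]
  exact Submodule.smul_mem _ c (single_mem_range_zeta A)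

/-- The zeta transform as a linear automorphism. -/
noncomputable def zetaEquiv : ZT ≃ₗ[ℤ] ZT := LinearEquiv.ofBijective zeta zeta_bijective

theorem zetaEquiv_apply (x : ZT) : zetaEquiv x = zeta x := rfl

theorem IsMonomialBasis.eq_zetaEquiv_symm {M : T → ZT} (hM : IsMonomialBasis M) (A : T) :
    M A = zetaEquiv.symm (Finsupp.single A 1) := by
  have h := hM.linearCombination_zeta (zetaEquiv.symm (Finsupp.single A 1))
  rw [← zetaEquiv_apply, LinearEquiv.apply_symm_apply, Finsupp.linearCombination_single,
    one_smul] at h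
  exact h

theorem existsUnique_isMonomialBasis : ∃! M : T → ZT, IsMonomialBasis M :=
  ⟨monomialBasis, isMonomialBasis_monomialBasis, fun M hM => funext fun A => by
    rw [hM.eq_zetaEquiv_symm, isMonomialBasis_monomialBasis.eq_zetaEquiv_symm]⟩

/-! ### The coproduct in the monomial basis -/

theorem deltaS_single (s : S) : deltaS (Finsupp.single s 1) =
    ∑ i ∈ Finset.range (s.size + 1),
      (Finsupp.single (s.restr (Finset.Icc 1 i)) (1 : ℤ) : ZS) ⊗ₜ[ℤ]
        (Finsupp.single (s.restr (Finset.Icc (i + 1) s.size)) (1 : ℤ) : ZS) := by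
  rw [deltaS, Finsupp.linearCombination_single, one_smul]

theorem linP_single (s : S) : linP (Finsupp.single s 1) = Finsupp.single (P s) 1 := by
  rw [linP, Finsupp.lmapDomain_apply, Finsupp.mapDomain_single]

theorem map_linP_deltaS_single (s : S) :
    TensorProduct.map linP linP (deltaS (Finsupp.single s 1)) =
      ∑ i ∈ Finset.range ((P s).size + 1),
        (Finsupp.single ((P s).low i) (1 : ℤ) : ZT) ⊗ₜ[ℤ]
          (Finsupp.single ((P s).high i) (1 : ℤ) : ZT) := by
  rw [deltaS_single, map_sum, size_P]
  refine Finset.sum_congr rfl fun i _ => ?_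
  rw [TensorProduct.map_tmul, linP_single, linP_single, low_P, high_P]

theorem deltaT_single (A : T) : deltaT (Finsupp.single A 1) =
    ∑ i ∈ Finset.range (A.size + 1),
      (Finsupp.single (A.low i) (1 : ℤ) : ZT) ⊗ₜ[ℤ] (Finsupp.single (A.high i) (1 : ℤ) : ZT) := by
  rw [deltaT, Finsupp.linearCombination_single, one_smul, map_linP_deltaS_single, P_word]

theorem deltaT_linP (x : ZS) :
    deltaT (linP x) = TensorProduct.map linP linP (deltaS x) := by
  induction x using Finsupp.induction_linear with
  | zero => simp only [map_zero]
  | add x y hx hy => simp only [map_add, hx, hy]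
  | single s c =>
    rw [← mul_one c, ← smul_eq_mul, ← Finsupp.smul_single, map_smul, map_smul, map_smul, map_smul,
      linP_single, deltaT_single, map_linP_deltaS_single]

/-- The coefficients of the zeta transform of an element of `ZT ⊗ ZT`. -/
noncomputable def zetaTensor : ZT ⊗[ℤ] ZT ≃ₗ[ℤ] (T × T →₀ ℤ) :=
  (TensorProduct.congr zetaEquiv zetaEquiv).trans (finsuppTensorFinsupp' ℤ T T)

theorem zetaTensor_tmul_apply (x y : ZT) (U V : T) :
    zetaTensor (x ⊗ₜ[ℤ] y) (U, V) = zeta x U * zeta y V := by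
  exact finsuppTensorFinsupp'_apply_apply ..

/-- The adjunction `T.weakLE_tri_iff` read on coefficients. The left tensor factor carries the small
letters, hence the reversal of `U` and `V`. -/
theorem zetaTensor_deltaT_apply (x : ZT) (U V : T) :
    zetaTensor (deltaT x) (U, V) = zeta x (V.tri U) := by
  classical
  have : (Finsupp.lapply (U, V)).comp (zetaTensor.toLinearMap.comp deltaT)
      = (Finsupp.lapply (V.tri U)).comp zeta := by
    refine Finsupp.lhom_ext' fun A => LinearMap.ext_ring ?_
    simp only [LinearMap.comp_apply, Finsupp.lsingle_apply, Finsupp.lapply_apply,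
      LinearEquiv.coe_coe]
    rw [deltaT_single, map_sum, Finsupp.finsetSum_apply, zeta_single_apply]
    simp only [zetaTensor_tmul_apply, zeta_single_apply]
    by_cases hU : U.size ≤ A.size
    -- Comparable tableaux have equal sizes and `A.low i` has size `i`, so only the cut at `i =
    -- U.size` can contribute.
    · rw [Finset.sum_eq_single U.size]
      · simp only [T.weakLE_tri_iff, hU, true_and, ite_and, mul_ite, mul_one, mul_zero]
        split_ifs <;> rfl
      · intro i hi hne
        rw [if_neg, zero_mul]
        intro h
        have := h.size_eq
        rw [T.size_low _ (by simpa [Nat.lt_succ_iff] using hi)] at this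
        exact hne this
      · intro h
        simp at h
        omega
    · rw [if_neg fun h => hU (T.weakLE_tri_iff.1 h).1]
      refine Finset.sum_eq_zero fun i hi => ?_
      rw [if_neg, zero_mul]
      intro h
      have := h.size_eq
      rw [T.size_low _ (by simpa [Nat.lt_succ_iff] using hi)] at this
      simp at hi
      omega
  exact LinearMap.congr_fun this x

/-! ### The unit and the primitive elements -/

theorem T.eq_empty_of_size {A : T} (h : A.size = 0) : A = T.empty := by
  refine Subtype.ext (List.eq_nil_iff_forall_not_mem.2 fun r hr => (A.2.1.1 r hr).1 ?_)
  exact List.flatten_eq_nil_iff.1 (List.length_eq_zero_iff.1 h) r hr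

theorem T.tri_empty (V : T) : V.tri T.empty = V := by
  have h : V.word.tri T.empty.word = V.word := Subtype.ext (by simp [S.tri, T.word, T.empty])
  rw [T.tri, h, P_word]

theorem T.empty_tri (U : T) : T.empty.tri U = U := by
  have h : T.empty.word.tri U.word = U.word := Subtype.ext (by simp [S.tri, T.word, T.empty])
  rw [T.tri, h, P_word]

open Classical in
theorem zeta_oneT_apply (A : T) : zeta oneT A = if A = T.empty then 1 else 0 := by
  rw [oneT, zeta_single_apply]
  congr 1
  refine propext ⟨fun h => T.eq_empty_of_size h.size_eq.symm, ?_⟩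
  rintro rfl
  exact .refl _

theorem mem_primitives_iff {x : ZT} :
    x ∈ primitives ↔ ∀ A : T, ¬ A.Indecomposable → zeta x A = 0 := by
  classical
  -- The primitivity equation, compared coefficient by coefficient on the `M U ⊗ M V`.
  have h1 : x ∈ primitives ↔ ∀ U V : T, zeta x (V.tri U)
      = zeta x U * (if V = T.empty then 1 else 0) + (if U = T.empty then 1 else 0) * zeta x V := by
    change deltaT x = x ⊗ₜ[ℤ] oneT + oneT ⊗ₜ[ℤ] x ↔ _
    rw [← zetaTensor.injective.eq_iff, Finsupp.ext_iff, Prod.forall]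
    simp only [zetaTensor_deltaT_apply, map_add, Finsupp.add_apply, zetaTensor_tmul_apply,
      zeta_oneT_apply]
  rw [h1]
  constructor
  · intro h A hA
    -- For `U` and `V` both empty, the equation says that this coefficient is twice itself.
    have h0 : zeta x T.empty = 0 := by
      have := h T.empty T.empty
      rw [T.tri_empty] at this
      simpa using this
    by_cases hA0 : A = T.empty
    · rw [hA0, h0]
    · simp only [T.Indecomposable, not_and, not_forall, not_or] at hA
      obtain ⟨V, U, rfl, hV, hU⟩ := hA hA0
      rw [h, if_neg hV, if_neg hU, mul_zero, zero_mul, add_zero]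
  · intro h U V
    have h0 : zeta x T.empty = 0 := h _ fun h => h.1 rfl
    by_cases hU : U = T.empty
    · subst hU
      simp [h0, T.tri_empty]
    · by_cases hV : V = T.empty
      · subst hV
        simp [hU, T.empty_tri]
      · rw [if_neg hV, if_neg hU, mul_zero, zero_mul, add_zero]
        exact h _ fun hI => (hI.2 V U rfl).elim hV hU

theorem primitives_eq_comap : primitives =
    (Finsupp.supported ℤ ℤ {A : T | A.Indecomposable}).comap zetaEquiv.toLinearMap := by
  ext x
  rw [mem_primitives_iff, Submodule.mem_comap, Finsupp.mem_supported']
  rfl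

/-! ### Grading and ranks -/

theorem monomialBasis_mem_homogeneous (A : T) : monomialBasis A ∈ homogeneous A.size := by
  classical
  induction hn : A.above.card using Nat.strong_induction_on generalizing A with
  | _ n ih =>
    rw [monomialBasis_eq]
    refine sub_mem (Finsupp.single_mem_supported _ _ rfl) (sum_mem fun W hW => ?_)
    rw [Finset.mem_erase, T.mem_above] at hW
    rw [hW.2.size_eq]
    exact ih _ (hn ▸ T.card_above_lt hW.2 hW.1) W rfl

/-- The zeta transform and its inverse both preserve degree. Writing the component as its own
preimage lets it be intersected with `primitives_eq_comap` on the side of coefficients. -/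
theorem homogeneous_eq_comap (n : ℕ) :
    homogeneous n = (homogeneous n).comap zetaEquiv.toLinearMap := by
  apply le_antisymm
  · conv_lhs => rw [homogeneous, Finsupp.supported_eq_span_single]
    rw [Submodule.span_le]
    rintro _ ⟨A, rfl, rfl⟩
    change zeta (Finsupp.single A 1) ∈ homogeneous A.size
    rw [zeta_single]
    exact sum_mem fun W hW => Finsupp.single_mem_supported _ _ (T.mem_above.1 hW).size_eq.symm
  · rw [Submodule.comap_equiv_eq_map_symm, Submodule.map_le_iff_le_comap]
    conv_lhs => rw [homogeneous, Finsupp.supported_eq_span_single]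
    rw [Submodule.span_le]
    rintro _ ⟨A, rfl, rfl⟩
    change zetaEquiv.symm (Finsupp.single A 1) ∈ homogeneous A.size
    rw [← isMonomialBasis_monomialBasis.eq_zetaEquiv_symm]
    exact monomialBasis_mem_homogeneous A

theorem IsMonomialBasis.primitives_eq_span {M : T → ZT} (hM : IsMonomialBasis M) :
    primitives = Submodule.span ℤ (M '' {A : T | A.Indecomposable}) := by
  rw [primitives_eq_comap, Submodule.comap_equiv_eq_map_symm, Finsupp.supported_eq_span_single,
    Submodule.map_span, Set.image_image]
  congr 1
  exact Set.image_congr fun A _ => (hM.eq_zetaEquiv_symm A).symm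

theorem primitives_eq_iSup : primitives = ⨆ n : ℕ, primitives ⊓ homogeneous n := by
  apply le_antisymm
  · conv_lhs => rw [isMonomialBasis_monomialBasis.primitives_eq_span]
    rw [Submodule.span_le]
    rintro _ ⟨A, hA, rfl⟩
    refine Submodule.mem_iSup_of_mem A.size ⟨?_, monomialBasis_mem_homogeneous A⟩
    rw [isMonomialBasis_monomialBasis.primitives_eq_span]
    exact Submodule.subset_span ⟨A, hA, rfl⟩
  · exact iSup_le fun n => inf_le_left

theorem finrank_primitives_inf_homogeneous (n : ℕ) :
    Module.finrank ℤ ↥(primitives ⊓ homogeneous n)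
      = {A : T | A.Indecomposable ∧ A.size = n}.ncard := by
  have hfin : {A : T | A.Indecomposable ∧ A.size = n}.Finite :=
    (finite_size n).subset fun A h => h.2
  have := hfin.fintype
  -- Through `zetaEquiv` the intersection becomes the free module on the indecomposable tableaux of
  -- size `n`, a finite set.
  rw [homogeneous_eq_comap, primitives_eq_comap, ← Submodule.comap_inf, homogeneous,
    ← Finsupp.supported_inter, Submodule.comap_equiv_eq_map_symm,
    LinearEquiv.finrank_map_eq, ← Set.ofPred_and,
    (Finsupp.supportedEquivFinsupp _).finrank_eq, Module.finrank_finsupp_self,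
    ← Nat.card_eq_fintype_card, Nat.card_coe_set_eq]

end TableauHopf

theorem mainTheorem2 :
    (Function.Surjective P ∧
      (∀ v u : S, P (v.tri u) = (P v).tri (P u)) ∧
      (∀ x : ZS, deltaT (linP x) = TensorProduct.map linP linP (deltaS x))) ∧
    (∃! M : T → ZT, IsMonomialBasis M) ∧
    ∀ M : T → ZT, IsMonomialBasis M →
      primitives = Submodule.span ℤ (M '' {A : T | A.Indecomposable}) ∧
      primitives = ⨆ n : ℕ, primitives ⊓ homogeneous n ∧
      ∀ n : ℕ, Module.finrank ℤ ↥(primitives ⊓ homogeneous n)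
        = {A : T | A.Indecomposable ∧ A.size = n}.ncard :=
  ⟨⟨P_surjective, P_tri, deltaT_linP⟩, existsUnique_isMonomialBasis, fun _ hM =>
    ⟨hM.primitives_eq_span, primitives_eq_iSup, finrank_primitives_inf_homogeneous⟩⟩
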